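/- Let $n\ge 0$ and let $\mu$ be a probability measure on the subsets of $[n]=\{1,\dots,n\}$ with generating polynomial $P_\mu(z_1,\dots,z_n)=\sum_{S\subseteq[n]}\mu(S)\prod_{i\in S}z_i$. Assume that $\mu$ is homogeneous (that is, $P_\mu$ is a homogeneous polynomial) and Strongly Rayleigh (that is, $P_\mu(z_1,\dots,z_n)\neq 0$ whenever $\operatorname{Im} z_i>0$ for all $i\in[n]$), and that all its marginal probabilities satisfy $\mathbb{P}_{S\sim\mu}[i\in S]\le\epsilon$ for $i\in[n]$. Let $A\in M_n(\mathbb{C})$ be a positive semidefinite matrix with operator norm $\|A\|\le 1$ whose diagonal entries are all at most $\alpha$. For $S\subseteq[n]$ let $A(S)$ be the principal submatrix of $A$ with rows and columns indexed by $S$, and let $\lambda_{\max}A(S)$ be its largest eigenvalue (with $\lambda_{\max}A(\emptyset)=-\infty$). If $\sqrt{\alpha}+\sqrt{\epsilon}\le 1$, then \[\mathbb{P}_{S\sim\mu}\left[\lambda_{\max}A(S)<4\epsilon^{1/4}+\alpha\right]>0.\] -/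

import Mathlib

open scoped ComplexOrder

noncomputable section

/-- A polynomial with real coefficients is real stable if it does not vanish when all the
variables lie in the open upper half plane. -/
def RealStable {σ : Type*} (p : MvPolynomial σ ℝ) : Prop :=
  ∀ z : σ → ℂ, (∀ i, 0 < (z i).im) → MvPolynomial.aeval z p ≠ 0

/-- The generating polynomial `∑ S, μ(S) z^S` of a probability measure on the subsets of `[n]`. -/
def generatingPoly {n : ℕ} (μ : PMF (Finset (Fin n))) : MvPolynomial (Fin n) ℝ :=
  ∑ S : Finset (Fin n), MvPolynomial.C (μ S).toReal * ∏ i ∈ S, MvPolynomial.X i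

/-- A probability measure on the subsets of `[n]` is strongly Rayleigh if its generating
polynomial is real stable. -/
def IsStronglyRayleigh {n : ℕ} (μ : PMF (Finset (Fin n))) : Prop :=
  RealStable (generatingPoly μ)

/-- A probability measure on the subsets of `[n]` is homogeneous if its generating polynomial
is homogeneous (of some degree). -/
def IsHomogeneousMeasure {n : ℕ} (μ : PMF (Finset (Fin n))) : Prop :=
  ∃ d : ℕ, (generatingPoly μ).IsHomogeneous d

/-- The probability of an event under a probability measure on the subsets of `[n]`. -/
def prob {n : ℕ} (μ : PMF (Finset (Fin n))) (E : Set (Finset (Fin n))) : ℝ :=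
  (μ.toOuterMeasure E).toReal

/-- The marginal probability of `i`: the probability that `i` belongs to the random set. -/
def marginal {n : ℕ} (μ : PMF (Finset (Fin n))) (i : Fin n) : ℝ :=
  prob μ {S | i ∈ S}

/-- A complex matrix is a contraction if its operator norm on Euclidean space is at most one. -/
def IsMatrixContraction {n : ℕ} (A : Matrix (Fin n) (Fin n) ℂ) : Prop :=
  ‖Matrix.toEuclideanCLM (n := Fin n) (𝕜 := ℂ) A‖ ≤ 1

/-- The principal submatrix `A(S)`, with rows and columns indexed by `S`. -/
def principalSubmatrix {n : ℕ} (A : Matrix (Fin n) (Fin n) ℂ) (S : Finset (Fin n)) :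
    Matrix S S ℂ :=
  A.submatrix Subtype.val Subtype.val

/-- The largest eigenvalue of a hermitian matrix, as an extended real number; the empty matrix
has no eigenvalue, and the value there is `-∞`. -/
def lambdaMax {ι : Type*} [Fintype ι] [DecidableEq ι] (M : Matrix ι ι ℂ) : EReal :=
  ⨆ r ∈ spectrum ℝ M, (r : EReal)

end

/-! Write `z`, `w` for two groups of `n` variables and put `f(z, w) = det(diag(z) - A) * P_μ(w)`,
which is affine in each variable and has no zeros when all variables lie in the upper half plane.
Applying all operators `∂/∂z_i + ∂/∂w_i` gives a function of `z + w` alone. Setting `w = 0` keeps,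
for the term `w^S`, only the choice of `∂/∂w_i` for `i ∈ S` and `∂/∂z_i` otherwise, so at constant
arguments the result is the mixture `∑ μ(S) χ_{A(S)}` at the point `z + w` (`pairDerivs_tensorMul`).

The largest root of this mixture is bounded by a barrier argument. Suppose that at all real points
above `(x, y)` the logarithmic derivatives of `f` are at most `a` in each `z_i` and `b` in each
`w_i`. Applying the `i`-th operator preserves the bounds for the other indices even after lowering
`w_i` by `1 / (a + b)` (`Barrier.pairDeriv`); the tool is the Rayleigh inequality `f * ∂_i ∂_j f ≤
∂_i f * ∂_j f`. Hence the mixture is positive from `x + y - 1 / (a + b)` on (`mixedCharpoly_pos`).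
Here `a` comes from a chord bound on the diagonal of the resolvent of `A`, and `b = ε / y` from
homogeneity and the bound on the marginals. The parameters are fixed in `barrier_value_lt`.

To pass from the mixture to a single set, condition on `i ∈ S` or `i ∉ S`, one index at a time.
Every positive reweighting of the two parts is again stable, so its mixture is real rooted. This
forces one of the two conditioned mixtures to be positive on the same half line
(`eval_pos_or_of_interlacing`). After all indices are decided, one set of positive weight remains
(`StableWeight.exists_eval_pos`). -/

/-! ### Multi-affine functions, the Rayleigh inequality and monotone logarithmic derivatives -/

section MultiAffine

variable {ι : Type*} [DecidableEq ι]

/-- The slope of `f` in the `i`-th variable; for a function that is affine in that variable it is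
the partial derivative. -/
def slopeIn (i : ι) (f : (ι → ℂ) → ℂ) : (ι → ℂ) → ℂ :=
  fun x => f (Function.update x i 1) - f (Function.update x i 0)

/-- A function that is affine in each variable separately. -/
def MultiAffine (f : (ι → ℂ) → ℂ) : Prop :=
  ∀ i x (t : ℂ), f (Function.update x i t) = f (Function.update x i 0) + t * slopeIn i f x

/-- A continuous function, affine in each variable, that is real at real points. -/
structure RealMultiAffine (f : (ι → ℂ) → ℂ) : Prop where
  affine : MultiAffine f
  cont : Continuous f
  real : ∀ x : ι → ℝ, (f fun i => (x i : ℂ)).im = 0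

/-- A function without zeros in the product of open upper half planes. -/
def NonvanishingOnUpper (f : (ι → ℂ) → ℂ) : Prop :=
  ∀ x : ι → ℂ, (∀ i, 0 < (x i).im) → f x ≠ 0

/-- The real value of `f` at a real point. -/
def realValue (f : (ι → ℂ) → ℂ) (x : ι → ℝ) : ℝ := (f fun i => (x i : ℂ)).re

theorem slopeIn_comm (i j : ι) (f : (ι → ℂ) → ℂ) :
    slopeIn i (slopeIn j f) = slopeIn j (slopeIn i f) := by
  rcases eq_or_ne i j with rfl | h
  · rfl
  funext x
  simp only [slopeIn, Function.update_comm h]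
  ring

theorem slopeIn_add (i : ι) (f g : (ι → ℂ) → ℂ) :
    slopeIn i (f + g) = slopeIn i f + slopeIn i g := by
  funext x
  simp only [slopeIn, Pi.add_apply]
  ring

theorem slopeIn_slopeIn_self (i : ι) (f : (ι → ℂ) → ℂ) : slopeIn i (slopeIn i f) = 0 := by
  funext x
  simp [slopeIn]

theorem MultiAffine.add {f g : (ι → ℂ) → ℂ} (hf : MultiAffine f) (hg : MultiAffine g) :
    MultiAffine (f + g) := by
  intro i x t
  rw [slopeIn_add, Pi.add_apply, Pi.add_apply, Pi.add_apply, hf i x t, hg i x t]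
  ring

theorem MultiAffine.slopeIn {f : (ι → ℂ) → ℂ} (hf : MultiAffine f) (i : ι) :
    MultiAffine (slopeIn i f) := by
  intro j x t
  rcases eq_or_ne i j with rfl | h
  · simp [_root_.slopeIn]
  · have h1 := hf j (Function.update x i 1) t
    have h0 := hf j (Function.update x i 0) t
    simp only [_root_.slopeIn, Function.update_comm h] at h1 h0 ⊢
    rw [h1, h0]
    ring

theorem MultiAffine.shift {f : (ι → ℂ) → ℂ} (hf : MultiAffine f) (i : ι) (x : ι → ℂ) (s : ℂ) :
    f (Function.update x i (x i + s)) = f x + s * _root_.slopeIn i f x := by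
  have h1 := hf i x (x i + s)
  have h2 := hf i x (x i)
  rw [Function.update_eq_self] at h2
  rw [h1, h2]
  ring

theorem MultiAffine.shift_shift {f : (ι → ℂ) → ℂ} (hf : MultiAffine f) {i j : ι} (h : i ≠ j)
    (x : ι → ℂ) (s t : ℂ) :
    f (Function.update (Function.update x i (x i + s)) j (x j + t)) =
      f x + s * _root_.slopeIn i f x + t * _root_.slopeIn j f x +
        s * t * _root_.slopeIn i (_root_.slopeIn j f) x := by
  have h1 := hf.shift j (Function.update x i (x i + s)) t
  rw [Function.update_of_ne h.symm] at h1
  rw [h1, hf.shift, (hf.slopeIn j).shift]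
  ring

theorem ofReal_update (x : ι → ℝ) (i : ι) (t : ℝ) :
    (fun k => ((Function.update x i t k : ℝ) : ℂ)) =
      Function.update (fun k => (x k : ℂ)) i (t : ℂ) := by
  funext k
  rcases eq_or_ne k i with rfl | h
  · simp
  · simp [h]

theorem RealMultiAffine.add {f g : (ι → ℂ) → ℂ} (hf : RealMultiAffine f)
    (hg : RealMultiAffine g) : RealMultiAffine (f + g) where
  affine := hf.affine.add hg.affine
  cont := hf.cont.add hg.cont
  real x := by simp [hf.real x, hg.real x]

theorem RealMultiAffine.slopeIn {f : (ι → ℂ) → ℂ} (hf : RealMultiAffine f) (i : ι) :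
    RealMultiAffine (slopeIn i f) where
  affine := hf.affine.slopeIn i
  cont := by
    have h (t : ℂ) : Continuous fun x : ι → ℂ => f (Function.update x i t) :=
      hf.cont.comp (continuous_id.update i continuous_const)
    exact (h 1).sub (h 0)
  real x := by
    have h1 := hf.real (Function.update x i 1)
    have h0 := hf.real (Function.update x i 0)
    rw [ofReal_update] at h1 h0
    simp only [Complex.ofReal_one, Complex.ofReal_zero] at h1 h0
    simp [_root_.slopeIn, h1, h0]

theorem RealMultiAffine.coe_realValue {f : (ι → ℂ) → ℂ} (hf : RealMultiAffine f) (x : ι → ℝ) :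
    (realValue f x : ℂ) = f fun i => (x i : ℂ) :=
  Complex.ext (by simp [realValue]) (by simp [hf.real x])

theorem realValue_add {κ : Type*} (f g : (κ → ℂ) → ℂ) (x : κ → ℝ) :
    realValue (f + g) x = realValue f x + realValue g x := by
  simp [realValue]

theorem RealMultiAffine.realValue_shift {f : (ι → ℂ) → ℂ} (hf : RealMultiAffine f) (i : ι)
    (x : ι → ℝ) (s : ℝ) :
    realValue f (Function.update x i (x i + s)) =
      realValue f x + s * realValue (_root_.slopeIn i f) x := by
  have h := hf.affine.shift i (fun k => (x k : ℂ)) s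
  rw [← Complex.ofReal_add, ← ofReal_update, ← hf.coe_realValue, ← hf.coe_realValue,
    ← (hf.slopeIn i).coe_realValue] at h
  exact_mod_cast h

/-- The Rayleigh inequality for real multi-affine functions without zeros in the upper half
plane. -/
theorem RealMultiAffine.rayleigh [Fintype ι] {f : (ι → ℂ) → ℂ} (hf : RealMultiAffine f)
    (hs : NonvanishingOnUpper f) {i j : ι} (hij : i ≠ j) (x : ι → ℝ) :
    realValue f x * realValue (_root_.slopeIn i (_root_.slopeIn j f)) x ≤
      realValue (_root_.slopeIn i f) x * realValue (_root_.slopeIn j f) x := by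
  by_contra! hlt
  set r0 := realValue f x with hr0
  set r1 := realValue (_root_.slopeIn i f) x with hr1
  set r2 := realValue (_root_.slopeIn j f) x with hr2
  set r12 := realValue (_root_.slopeIn i (_root_.slopeIn j f)) x with hr12
  -- Move the `i`-th variable by `I` and solve for the displacement `-num / den` of the `j`-th one
  -- that makes `f` vanish. At a real base point its imaginary part has the sign of `r0 * r12 - r1 *
  -- r2`, positive by assumption. A small shift of the base point by `η * I` keeps this sign and
  -- puts the other variables in the open upper half plane.
  let X : ℝ → ι → ℂ := fun η k => (x k : ℂ) + η * Complex.I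
  have hX : Continuous X := by fun_prop
  have hX0 : X 0 = fun k => (x k : ℂ) := by funext k; simp [X]
  let num : ℝ → ℂ := fun η => f (X η) + Complex.I * _root_.slopeIn i f (X η)
  let den : ℝ → ℂ := fun η =>
    _root_.slopeIn j f (X η) + Complex.I * _root_.slopeIn i (_root_.slopeIn j f) (X η)
  have hnum : Continuous num :=
    (hf.cont.comp hX).add (continuous_const.mul ((hf.slopeIn i).cont.comp hX))
  have hden : Continuous den :=
    ((hf.slopeIn j).cont.comp hX).add
      (continuous_const.mul (((hf.slopeIn j).slopeIn i).cont.comp hX))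
  have hnum0 : num 0 = r0 + Complex.I * r1 := by
    simp only [num, hX0, hr0, hr1, hf.coe_realValue, (hf.slopeIn i).coe_realValue]
  have hden0 : den 0 = r2 + Complex.I * r12 := by
    simp only [den, hX0, hr2, hr12, (hf.slopeIn j).coe_realValue,
      ((hf.slopeIn j).slopeIn i).coe_realValue]
  have hsq : 0 < r2 ^ 2 + r12 ^ 2 := by
    by_contra! h
    have h2 : r2 = 0 := by nlinarith [sq_nonneg r2, sq_nonneg r12]
    have h12 : r12 = 0 := by nlinarith [sq_nonneg r2, sq_nonneg r12]
    simp [h2, h12] at hlt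
  have hden_ne : den 0 ≠ 0 := by
    rw [hden0]
    intro h
    have h1 := congrArg Complex.re h
    have h2 := congrArg Complex.im h
    simp at h1 h2
    simp [h1, h2] at hsq
  have him0 : 0 < (-(num 0) / den 0).im := by
    rw [hnum0, hden0, Complex.div_im]
    have : Complex.normSq ((r2 : ℂ) + Complex.I * r12) = r2 ^ 2 + r12 ^ 2 := by
      simp [Complex.normSq_apply]; ring
    rw [this]
    simp only [Complex.neg_im, Complex.neg_re, Complex.add_re, Complex.add_im, Complex.mul_re,
      Complex.mul_im, Complex.I_re, Complex.I_im, Complex.ofReal_re, Complex.ofReal_im]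
    rw [← sub_div]
    apply div_pos _ hsq
    linarith
  have hcont : ContinuousAt (fun η => (-(num η) / den η).im) 0 :=
    Complex.continuous_im.continuousAt.comp
      ((hnum.neg.continuousAt).div hden.continuousAt hden_ne)
  have hev := (hcont.eventually (lt_mem_nhds him0)).and (hden.continuousAt.eventually_ne hden_ne)
  obtain ⟨η, hη, hηpos⟩ :=
    ((hev.filter_mono nhdsWithin_le_nhds).and (self_mem_nhdsWithin (s := Set.Ioi (0 : ℝ)))).exists
  obtain ⟨him, hne⟩ := hη
  replace hηpos : 0 < η := hηpos
  refine hs (Function.update (Function.update (X η) i (X η i + Complex.I)) j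
    (X η j + -(num η) / den η)) ?_ ?_
  · have hXim (k : ι) : (X η k).im = η := by simp [X]
    intro k
    rcases eq_or_ne k j with rfl | hkj
    · rw [Function.update_self, Complex.add_im, hXim]
      linarith
    rw [Function.update_of_ne hkj]
    rcases eq_or_ne k i with rfl | hki
    · rw [Function.update_self, Complex.add_im, hXim, Complex.I_im]
      linarith
    · rw [Function.update_of_ne hki, hXim]
      exact hηpos
  · rw [hf.affine.shift_shift hij]
    have : -(num η) / den η * den η = -(num η) := div_mul_cancel₀ _ hne
    simp only [num, den] at this ⊢
    linear_combination this

/-- Along a coordinate `f` is affine, so a negative slope would make it negative far enough out. -/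
theorem realValue_slopeIn_nonneg {f : (ι → ℂ) → ℂ} (hf : RealMultiAffine f) {X : ι → ℝ}
    (hpos : ∀ Y, X ≤ Y → 0 ≤ realValue f Y) (i : ι) {Y : ι → ℝ} (hY : X ≤ Y) :
    0 ≤ realValue (slopeIn i f) Y := by
  by_contra! h
  set s := (realValue f Y + 1) / (-realValue (slopeIn i f) Y) with hs
  have hs0 : 0 ≤ s := div_nonneg (by linarith [hpos Y hY]) (by linarith)
  have h1 := hpos (Function.update Y i (Y i + s))
    (hY.trans (le_update_iff.2 ⟨by linarith, fun _ _ => le_rfl⟩))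
  rw [hf.realValue_shift] at h1
  have h2 : s * -realValue (slopeIn i f) Y = realValue f Y + 1 :=
    div_mul_cancel₀ _ (by linarith)
  linarith

/-- A bound on a logarithmic derivative at a point persists at all larger points. -/
theorem realValue_slopeIn_le_of_le [Fintype ι] {f : (ι → ℂ) → ℂ} (hf : RealMultiAffine f)
    (hs : NonvanishingOnUpper f) {X : ι → ℝ} (hpos : ∀ Y, X ≤ Y → 0 < realValue f Y) {k : ι}
    {c : ℝ} (hc : 0 ≤ c) (hX : realValue (slopeIn k f) X ≤ c * realValue f X) {Y : ι → ℝ}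
    (hY : X ≤ Y) : realValue (slopeIn k f) Y ≤ c * realValue f Y := by
  suffices H : ∀ T : Finset ι, realValue (slopeIn k f) (T.piecewise Y X) ≤
      c * realValue f (T.piecewise Y X) by simpa using H Finset.univ
  intro T
  induction T using Finset.induction_on with
  | empty => simpa using hX
  | insert i T hi ih =>
    set Z := T.piecewise Y X with hZ
    have hXZ : X ≤ Z := Finset.le_piecewise_of_le_of_le T hY le_rfl
    have hZi : Z i = X i := by simp [hZ, hi]
    have hval : (insert i T).piecewise Y X = Function.update Z i (Z i + (Y i - X i)) := by
      rw [Finset.piecewise_insert, hZi]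
      congr 1
      ring
    have hsn : 0 ≤ Y i - X i := sub_nonneg.2 (hY i)
    have h0 := hpos Z hXZ
    have h1 := realValue_slopeIn_nonneg hf (fun Y hY => (hpos Y hY).le) i hXZ
    rw [hval, hf.realValue_shift, (hf.slopeIn k).realValue_shift]
    -- By Rayleigh and the induction hypothesis, `f * f_ik ≤ f_i * f_k ≤ c * f * f_i`, and `f > 0`
    -- can be cancelled. Thus the bound survives raising one coordinate.
    have key : realValue (slopeIn i (slopeIn k f)) Z ≤ c * realValue (slopeIn i f) Z := by
      rcases eq_or_ne i k with rfl | hik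
      · rw [slopeIn_slopeIn_self]
        simpa [realValue] using mul_nonneg hc h1
      · have h2 := hf.rayleigh hs hik Z
        have h3 := mul_le_mul_of_nonneg_left ih h1
        by_contra! h4
        have h5 := mul_lt_mul_of_pos_left h4 h0
        nlinarith
    have := mul_le_mul_of_nonneg_left key hsn
    linarith

/-- A function affine in each variable that vanishes on a real orthant is zero. -/
theorem MultiAffine.eq_zero_of_orthant [Fintype ι] {f : (ι → ℂ) → ℂ} (hf : MultiAffine f)
    (X : ι → ℝ) (h : ∀ Y : ι → ℝ, X ≤ Y → f (fun i => (Y i : ℂ)) = 0) : f = 0 := by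
  suffices H : ∀ (T : Finset ι) (x : ι → ℂ) (Y : ι → ℝ), X ≤ Y →
      f (T.piecewise x fun i => (Y i : ℂ)) = 0 by
    funext x
    simpa using H Finset.univ x X le_rfl
  intro T
  induction T using Finset.induction_on with
  | empty => intro x Y hY; simpa using h Y hY
  | insert i T hi ih =>
    intro x Y hY
    set Z := T.piecewise x fun i => (Y i : ℂ) with hZ
    have hZi : Z i = Y i := by simp [hZ, hi]
    have h0 : f Z = 0 := ih x Y hY
    have h1 : f (Function.update Z i (Z i + 1)) = 0 := by
      have h2 := ih x (Function.update Y i (Y i + 1))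
        (hY.trans (le_update_iff.2 ⟨by linarith, fun _ _ => le_rfl⟩))
      have h3 : (T.piecewise x fun k => ((Function.update Y i (Y i + 1) k : ℝ) : ℂ)) =
          Function.update Z i (Z i + 1) := by
        funext k
        rcases eq_or_ne k i with rfl | hk
        · simp [hi, hZi]
        · by_cases hkT : k ∈ T <;> simp [hZ, hk, hkT]
      rwa [h3] at h2
    have h4 : (insert i T).piecewise x (fun i => (Y i : ℂ)) =
        Function.update Z i (Z i + (x i - Y i)) := by
      rw [Finset.piecewise_insert, hZi]
      congr 1
      ring
    rw [hf.shift, h0] at h1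
    rw [h4, hf.shift, h0]
    linear_combination (x i - Y i) * h1

end MultiAffine

/-! ### The operators `∂/∂z_i + ∂/∂w_i`: stability, barrier shift and evaluation -/

section PairDerivative

variable {κ : Type*} [DecidableEq κ]

/-- The operator `∂/∂z_i + ∂/∂w_i` on functions of two groups of variables `z` and `w`. -/
def pairDeriv (i : κ) (f : (κ ⊕ κ → ℂ) → ℂ) : (κ ⊕ κ → ℂ) → ℂ :=
  slopeIn (Sum.inl i) f + slopeIn (Sum.inr i) f

/-- The composition of the operators `∂/∂z_i + ∂/∂w_i` over a list of indices. -/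
def pairDerivs : List κ → ((κ ⊕ κ → ℂ) → ℂ) → (κ ⊕ κ → ℂ) → ℂ
  | [], f => f
  | i :: L, f => pairDerivs L (pairDeriv i f)

/-- All the partial derivatives of `f` in distinct variables `z_i`, with `i` in a list, are
without zeros in the upper half plane. -/
def StableChain : List κ → ((κ ⊕ κ → ℂ) → ℂ) → Prop
  | [], f => NonvanishingOnUpper f
  | i :: L, f => StableChain L f ∧ StableChain L (slopeIn (Sum.inl i) f)

theorem StableChain.nonvanishing {L : List κ} {f : (κ ⊕ κ → ℂ) → ℂ} (h : StableChain L f) :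
    NonvanishingOnUpper f := by
  induction L with
  | nil => exact h
  | cons i L ih => exact ih h.1

theorem RealMultiAffine.pairDeriv {f : (κ ⊕ κ → ℂ) → ℂ} (hf : RealMultiAffine f) (i : κ) :
    RealMultiAffine (pairDeriv i f) :=
  (hf.slopeIn _).add (hf.slopeIn _)

theorem slopeIn_pairDeriv (k : κ ⊕ κ) (i : κ) (f : (κ ⊕ κ → ℂ) → ℂ) :
    slopeIn k (pairDeriv i f) = pairDeriv i (slopeIn k f) := by
  rw [pairDeriv, pairDeriv, slopeIn_add, slopeIn_comm k, slopeIn_comm k]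

/-- The two roots sum to `-b / c`, so they cannot both have nonpositive imaginary part. -/
theorem exists_upper_root (r0 b c : ℂ) (hc : c ≠ 0) (hb : 0 < (-b / c).im) :
    ∃ s : ℂ, 0 < s.im ∧ r0 + b * s + c * s ^ 2 = 0 := by
  obtain ⟨δ, hδ⟩ := IsAlgClosed.exists_pow_nat_eq (b ^ 2 / (4 * c ^ 2) - r0 / c) (n := 2) two_pos
  wlog h : 0 ≤ δ.im generalizing δ
  · exact this (-δ) (by rw [neg_sq, hδ]) (by rw [Complex.neg_im]; linarith)
  refine ⟨-b / c / 2 + δ, ?_, ?_⟩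
  · rw [Complex.add_im, Complex.div_ofNat_im]
    linarith
  · have : c * δ ^ 2 = b ^ 2 / (4 * c) - r0 := by rw [hδ]; field_simp
    have h2 : c * (-b / c / 2 + δ) ^ 2 = b ^ 2 / (4 * c) - b * δ + c * δ ^ 2 := by
      field_simp; ring
    rw [h2, this]
    field_simp
    ring

/-- Suppose the two slopes at `x` cancel. If the mixed slope is nonzero, restrict `f` to `z_i = w_i
= s`: this is a quadratic in `s` whose roots sum to `x(z_i) + x(w_i)`, so one lies in the upper half
plane. If it is zero, moving both variables by `M * I` leaves `f` unchanged, and a further finite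
move of `z_i` reaches a zero of `f`; this is where the slope in `z_i` must not vanish. -/
theorem NonvanishingOnUpper.pairDeriv {f : (κ ⊕ κ → ℂ) → ℂ} (hf : MultiAffine f) {i : κ}
    (h0 : NonvanishingOnUpper f) (h1 : NonvanishingOnUpper (slopeIn (Sum.inl i) f)) :
    NonvanishingOnUpper (pairDeriv i f) := by
  intro x hx hzero
  have hne : (Sum.inl i : κ ⊕ κ) ≠ Sum.inr i := Sum.inl_ne_inr
  have upd (s t : ℂ) (hs : 0 < s.im) (ht : 0 < t.im) (k : κ ⊕ κ) :
      0 < (Function.update (Function.update x (Sum.inl i) s) (Sum.inr i) t k).im := by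
    rcases eq_or_ne k (Sum.inr i) with rfl | hk
    · simpa using ht
    rw [Function.update_of_ne hk]
    rcases eq_or_ne k (Sum.inl i) with rfl | hk'
    · simpa using hs
    · rw [Function.update_of_ne hk']
      exact hx k
  have hval (s t : ℂ) := hf.shift_shift hne x (s - x (Sum.inl i)) (t - x (Sum.inr i))
  simp only [add_sub_cancel] at hval
  set u := x (Sum.inl i)
  set v := x (Sum.inr i)
  set r1 := slopeIn (Sum.inl i) f x
  set r2 := slopeIn (Sum.inr i) f x with hr2
  set r12 := slopeIn (Sum.inl i) (slopeIn (Sum.inr i) f) x with hr12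
  have hsum : r1 + r2 = 0 := hzero
  have hu : 0 < u.im := hx _
  have hv : 0 < v.im := hx _
  by_cases h12 : r12 = 0
  · have hr1 : r1 ≠ 0 := h1 x hx
    set q := -f x / r1 with hq
    obtain ⟨M, hM⟩ : ∃ M : ℝ, |q.im| < M := exists_gt _
    have hM' := abs_lt.1 hM
    have hM0 : 0 < M := (abs_nonneg _).trans_lt hM
    refine h0 _ (upd (u + q + M * Complex.I) (v + M * Complex.I) ?_ ?_) ?_
    · simp; linarith
    · simp; linarith
    · rw [hval, h12]
      have : r1 * q = -f x := mul_div_cancel₀ _ hr1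
      linear_combination this + M * Complex.I * hsum
  · have hb : 0 < (-(r1 + r2 - (u + v) * r12) / r12).im := by
      rw [hsum]
      have : -(0 - (u + v) * r12) / r12 = u + v := by field_simp; ring
      rw [this, Complex.add_im]
      linarith
    obtain ⟨s, hs, hs0⟩ := exists_upper_root (f x - u * r1 - v * r2 + u * v * r12)
      (r1 + r2 - (u + v) * r12) r12 h12 hb
    refine h0 _ (upd s s hs hs) ?_
    rw [hval]
    linear_combination hs0

/-- One step needs `f` and its `z_i`-derivative to be free of zeros, so iterating needs this for all
iterated `z`-derivatives. The hypothesis is inherited because slopes commute with the operators. -/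
theorem StableChain.pairDeriv {L : List κ} {i : κ} {f : (κ ⊕ κ → ℂ) → ℂ} (hf : MultiAffine f)
    (h : StableChain (i :: L) f) : StableChain L (pairDeriv i f) := by
  induction L generalizing f with
  | nil => exact NonvanishingOnUpper.pairDeriv hf h.1 h.2
  | cons j L ih =>
    obtain ⟨⟨h1, h2⟩, h3, h4⟩ := h
    refine ⟨ih hf ⟨h1, h3⟩, ?_⟩
    rw [slopeIn_pairDeriv]
    refine ih (hf.slopeIn _) ⟨h2, ?_⟩
    rwa [slopeIn_comm]

/-- Bounds on the logarithmic derivatives of `f` at all real points above `X`. -/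
structure Barrier (a b : ℝ) (L : List κ) (f : (κ ⊕ κ → ℂ) → ℂ) (X : κ ⊕ κ → ℝ) : Prop where
  pos : ∀ Y, X ≤ Y → 0 < realValue f Y
  left : ∀ Y, X ≤ Y → ∀ j ∈ L, realValue (slopeIn (Sum.inl j) f) Y ≤ a * realValue f Y
  right : ∀ Y, X ≤ Y → ∀ j ∈ L, realValue (slopeIn (Sum.inr j) f) Y ≤ b * realValue f Y

/-- With `t = 1 / (a + b)`, every point `Y` above the lowered corner becomes a point above `X` when
`t` is added to `w_i`. The logarithmic derivative of the new function at `Y` is at most that of `f`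
at this raised point, where the old bound applies. -/
theorem Barrier.pairDeriv [Fintype κ] {a b : ℝ} {L : List κ} {i : κ} {f : (κ ⊕ κ → ℂ) → ℂ}
    {X : κ ⊕ κ → ℝ} (hf : RealMultiAffine f) (hs : StableChain (i :: L) f) (hi : i ∉ L)
    (ha : 0 < a) (hb : 0 < b) (h : Barrier a b (i :: L) f X) :
    Barrier a b L (pairDeriv i f)
      (Function.update X (Sum.inr i) (X (Sum.inr i) - 1 / (a + b))) := by
  set t := 1 / (a + b) with ht
  set X' := Function.update X (Sum.inr i) (X (Sum.inr i) - t) with hX'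
  set u : κ ⊕ κ := Sum.inl i
  set v : κ ⊕ κ := Sum.inr i with hv
  have hab : 0 < a + b := add_pos ha hb
  have ht0 : 0 < t := one_div_pos.2 hab
  have htab : t * a + t * b = 1 := by rw [← mul_add, ht, one_div_mul_cancel hab.ne']
  have hns := hs.nonvanishing
  have lift (Y : κ ⊕ κ → ℝ) (hY : X' ≤ Y) : X ≤ Function.update Y v (Y v + t) := by
    intro k
    have := hY k
    rcases eq_or_ne k v with rfl | hk
    · simp only [hX', Function.update_self] at this ⊢
      linarith
    · rw [Function.update_of_ne hk]
      rwa [hX', Function.update_of_ne hk] at this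
  have nonneg := realValue_slopeIn_nonneg hf fun Y hY => (h.pos Y hY).le
  -- `f` and its derivatives at a point above `X'`
  have facts (Y : κ ⊕ κ → ℝ) (hY : X' ≤ Y) : 0 < realValue f Y ∧
      t * realValue (slopeIn u f) Y ≤ realValue f Y ∧ 0 ≤ realValue (slopeIn v f) Y := by
    have hl := lift Y hY
    have e0 := h.pos _ hl
    have e1 := h.left _ hl i List.mem_cons_self
    have e2 := h.right _ hl i List.mem_cons_self
    have e3 := nonneg v hl
    have e12 := realValue_slopeIn_nonneg (hf.slopeIn u) (fun Y hY => nonneg u hY) v hl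
    change realValue (slopeIn u f) _ ≤ _ at e1
    change realValue (slopeIn v f) _ ≤ _ at e2
    have s1 := (hf.slopeIn u).realValue_shift v Y t
    have s0 := hf.realValue_shift v Y t
    have s2 := (hf.slopeIn v).realValue_shift v Y t
    have s12 := ((hf.slopeIn u).slopeIn v).realValue_shift v Y t
    rw [slopeIn_slopeIn_self] at s2 s12
    simp only [show ∀ y : κ ⊕ κ → ℝ, realValue 0 y = 0 from fun y => by simp [realValue],
      mul_zero, add_zero] at s2 s12
    set F := realValue f (Function.update Y v (Y v + t))
    set F1 := realValue (slopeIn u f) (Function.update Y v (Y v + t))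
    rw [s2] at e2 e3
    rw [s12] at e12
    have m1 := mul_le_mul_of_nonneg_left e1 ht0.le
    have m2 := mul_le_mul_of_nonneg_left e2 ht0.le
    have m12 := mul_nonneg ht0.le (mul_nonneg ht0.le e12)
    -- Since `t * a + t * b = 1`, `f = F - t * f_v ≥ t * a * F > 0`. Also `t * f_u ≤ t * F1 ≤ t * a
    -- * F ≤ f`, as the mixed slope is nonnegative.
    have m : t * (a * F) + t * (b * F) = F := by linear_combination F * htab
    have ma : 0 < t * (a * F) := by positivity
    refine ⟨by linarith, ?_, e3⟩
    nlinarith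
  have pos1 (Y : κ ⊕ κ → ℝ) (hY : X' ≤ Y) : 0 ≤ realValue (slopeIn u f) Y :=
    realValue_slopeIn_nonneg hf (fun Y hY => (facts Y hY).1.le) u hY
  have pos1' (Y : κ ⊕ κ → ℝ) (hY : X' ≤ Y) : 0 < realValue (slopeIn u f) Y := by
    -- If the slope vanished at `Y`, the bound with constant `0` would persist above `Y` and force
    -- the slope to be identically zero, against stability.
    refine (pos1 Y hY).lt_of_ne' fun hzero => ?_
    have hz : slopeIn u f = 0 := by
      refine (hf.slopeIn u).affine.eq_zero_of_orthant Y fun Z hZ => ?_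
      rw [← (hf.slopeIn u).coe_realValue]
      have h1 := realValue_slopeIn_le_of_le hf hns (X := Y) (c := 0) (k := u)
        (fun Z hZ => (facts Z (hY.trans hZ)).1) le_rfl (by rw [hzero, zero_mul]) hZ
      rw [zero_mul] at h1
      exact_mod_cast h1.antisymm (pos1 Z (hY.trans hZ))
    exact hs.2.nonvanishing (fun _ => Complex.I) (by simp) (by rw [hz]; rfl)
  have posD (Y : κ ⊕ κ → ℝ) (hY : X' ≤ Y) : 0 < realValue (_root_.pairDeriv i f) Y := by
    rw [_root_.pairDeriv, realValue_add]
    exact add_pos_of_pos_of_nonneg (pos1' Y hY) (facts Y hY).2.2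
  -- transfer of a bound
  have main (k : κ ⊕ κ) (hku : u ≠ k) (hkv : v ≠ k) (c : ℝ) (Y : κ ⊕ κ → ℝ) (hY : X' ≤ Y)
      (hk : realValue (slopeIn k f) (Function.update Y v (Y v + t)) ≤
        c * realValue f (Function.update Y v (Y v + t))) :
      realValue (slopeIn k (_root_.pairDeriv i f)) Y ≤ c * realValue (_root_.pairDeriv i f) Y := by
    obtain ⟨f0, f1, f2⟩ := facts Y hY
    have R1 := hf.rayleigh hns hku Y
    have R2 := hf.rayleigh hns hkv Y
    have hG := posD Y hY
    rw [hf.realValue_shift, (hf.slopeIn k).realValue_shift] at hk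
    rw [slopeIn_pairDeriv, _root_.pairDeriv, realValue_add]
    rw [_root_.pairDeriv, realValue_add] at hG ⊢
    change 0 < realValue (slopeIn u f) Y + realValue (slopeIn v f) Y at hG
    change realValue (slopeIn u (slopeIn k f)) Y + realValue (slopeIn v (slopeIn k f)) Y ≤
      c * (realValue (slopeIn u f) Y + realValue (slopeIn v f) Y)
    generalize realValue (slopeIn u (slopeIn k f)) Y = r13 at *
    generalize realValue (slopeIn v (slopeIn k f)) Y = r23 at *
    generalize realValue (slopeIn k f) Y = r3 at *
    generalize realValue (slopeIn u f) Y = r1 at *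
    generalize realValue (slopeIn v f) Y = r2 at *
    generalize realValue f Y = r0 at *
    have hF : 0 < r0 + t * r2 := by positivity
    have k1 := mul_nonneg (sub_nonneg.2 R1) hF.le
    have k2 := mul_nonneg (sub_nonneg.2 R2) (sub_nonneg.2 f1)
    -- The right side equals `(r1 * r3 - r0 * r13) * (r0 + t * r2) + (r2 * r3 - r0 * r23) * (r0 - t
    -- * r1)`, a sum of the two products in `k1` and `k2`.
    have k3 : 0 ≤ r0 * ((r1 + r2) * (r3 + t * r23) - (r13 + r23) * (r0 + t * r2)) := by
      linarith
    have k4 := nonneg_of_mul_nonneg_right k3 f0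
    have k5 := mul_le_mul_of_nonneg_left hk hG.le
    refine le_of_mul_le_mul_right (a := r0 + t * r2) ?_ hF
    linarith
  have hne (j : κ) (hj : j ∈ L) : i ≠ j := fun hij => hi (hij ▸ hj)
  exact
    { pos := posD
      left := fun Y hY j hj => main _ (Sum.inl_injective.ne (hne j hj)) Sum.inr_ne_inl a Y hY
        (h.left _ (lift Y hY) j (List.mem_cons_of_mem _ hj))
      right := fun Y hY j hj => main _ Sum.inl_ne_inr (Sum.inr_injective.ne (hne j hj)) b Y hY
        (h.right _ (lift Y hY) j (List.mem_cons_of_mem _ hj)) }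

theorem Barrier.pairDerivs_pos [Fintype κ] {a b : ℝ} {L : List κ} {f : (κ ⊕ κ → ℂ) → ℂ}
    {X : κ ⊕ κ → ℝ} (hf : RealMultiAffine f) (hs : StableChain L f) (hL : L.Nodup)
    (ha : 0 < a) (hb : 0 < b) (h : Barrier a b L f X) {Y : κ ⊕ κ → ℝ}
    (hl : ∀ i, X (Sum.inl i) ≤ Y (Sum.inl i))
    (hr : ∀ i, (if i ∈ L then X (Sum.inr i) - 1 / (a + b) else X (Sum.inr i)) ≤ Y (Sum.inr i)) :
    0 < realValue (pairDerivs L f) Y := by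
  induction L generalizing f X with
  | nil =>
    refine h.pos Y ?_
    rintro (i | i)
    · exact hl i
    · simpa using hr i
  | cons i L ih =>
    obtain ⟨hiL, hL⟩ := List.nodup_cons.1 hL
    refine ih (hf.pairDeriv i) (hs.pairDeriv hf.affine) hL (h.pairDeriv hf hs hiL ha hb) ?_ ?_
    · simpa using hl
    · intro j
      have := hr j
      rcases eq_or_ne j i with rfl | hj
      · simpa [hiL] using this
      · simpa [hj] using this

theorem StableChain.pairDerivs {L : List κ} {f : (κ ⊕ κ → ℂ) → ℂ} (hf : RealMultiAffine f)
    (hs : StableChain L f) : NonvanishingOnUpper (pairDerivs L f) := by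
  induction L generalizing f with
  | nil => exact hs
  | cons i L ih => exact ih (hf.pairDeriv i) (hs.pairDeriv hf.affine)

/-- `f` depends on `z_i` and `w_i` only through `z_i + w_i`. -/
def DependsOnSum (i : κ) (f : (κ ⊕ κ → ℂ) → ℂ) : Prop :=
  ∀ x s, f (Function.update (Function.update x (Sum.inl i) (x (Sum.inl i) + s))
    (Sum.inr i) (x (Sum.inr i) - s)) = f x

/-- `(∂_z - ∂_w)(∂_z + ∂_w) = ∂_z² - ∂_w²` kills functions affine in both variables. -/
theorem MultiAffine.dependsOnSum_pairDeriv {f : (κ ⊕ κ → ℂ) → ℂ} (hf : MultiAffine f) (i : κ) :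
    DependsOnSum i (pairDeriv i f) := by
  intro x s
  have h := ((hf.slopeIn (Sum.inl i)).add (hf.slopeIn (Sum.inr i))).shift_shift
    (Sum.inl_ne_inr (a := i) (b := i)) x s (-s)
  have h2 : _root_.slopeIn (Sum.inl i)
      (_root_.slopeIn (Sum.inr i) (_root_.slopeIn (Sum.inl i) f)) = 0 := by
    rw [slopeIn_comm (Sum.inr i), slopeIn_slopeIn_self]
  have h3 : _root_.slopeIn (Sum.inl i) (0 : (κ ⊕ κ → ℂ) → ℂ) = 0 := by
    funext x
    simp [_root_.slopeIn]
  simp only [slopeIn_add, slopeIn_slopeIn_self, h2, h3, Pi.add_apply, Pi.zero_apply] at h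
  rw [slopeIn_comm (Sum.inr i) (Sum.inl i)] at h
  rw [sub_eq_add_neg, pairDeriv, Pi.add_apply, Pi.add_apply, h]
  ring

theorem DependsOnSum.slopeIn {f : (κ ⊕ κ → ℂ) → ℂ} {i : κ} (h : DependsOnSum i f) {k : κ ⊕ κ}
    (h1 : k ≠ Sum.inl i) (h2 : k ≠ Sum.inr i) : DependsOnSum i (slopeIn k f) := by
  intro x s
  have e (t : ℂ) := h (Function.update x k t) s
  simp only [Function.update_of_ne h1.symm, Function.update_of_ne h2.symm] at e
  simp only [_root_.slopeIn, Function.update_comm h1.symm, Function.update_comm h2.symm] at e ⊢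
  rw [← e 1, ← e 0]

theorem DependsOnSum.pairDeriv {f : (κ ⊕ κ → ℂ) → ℂ} {i j : κ} (h : DependsOnSum i f)
    (hij : j ≠ i) : DependsOnSum i (pairDeriv j f) := by
  intro x s
  have h1 := h.slopeIn (k := Sum.inl j) (Sum.inl_injective.ne hij) Sum.inl_ne_inr x s
  have h2 := h.slopeIn (k := Sum.inr j) Sum.inr_ne_inl (Sum.inr_injective.ne hij) x s
  rw [_root_.pairDeriv, Pi.add_apply, Pi.add_apply, h1, h2]

theorem DependsOnSum.pairDerivs {f : (κ ⊕ κ → ℂ) → ℂ} {i : κ} {L : List κ}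
    (h : DependsOnSum i f) (hi : i ∉ L) : DependsOnSum i (pairDerivs L f) := by
  induction L generalizing f with
  | nil => exact h
  | cons j L ih =>
    exact ih (h.pairDeriv (List.ne_of_not_mem_cons hi).symm) (List.not_mem_of_not_mem_cons hi)

theorem MultiAffine.pairDeriv {f : (κ ⊕ κ → ℂ) → ℂ} (hf : MultiAffine f) (i : κ) :
    MultiAffine (pairDeriv i f) :=
  (hf.slopeIn _).add (hf.slopeIn _)

theorem MultiAffine.dependsOnSum_pairDerivs {f : (κ ⊕ κ → ℂ) → ℂ} (hf : MultiAffine f) {i : κ}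
    {L : List κ} (hL : L.Nodup) (hi : i ∈ L) : DependsOnSum i (pairDerivs L f) := by
  induction L generalizing f with
  | nil => simp at hi
  | cons j L ih =>
    obtain ⟨hj, hL⟩ := List.nodup_cons.1 hL
    rcases List.mem_cons.1 hi with rfl | hi
    · exact (hf.dependsOnSum_pairDeriv i).pairDerivs hj
    · exact ih (hf.pairDeriv j) hL hi

theorem eq_of_dependsOnSum [Fintype κ] {f : (κ ⊕ κ → ℂ) → ℂ} (h : ∀ i, DependsOnSum i f)
    (z w : κ → ℂ) : f (Sum.elim z w) = f (Sum.elim (z + w) 0) := by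
  suffices H : ∀ T : Finset κ, f (Sum.elim z w) =
      f (Sum.elim (T.piecewise (z + w) z) (T.piecewise 0 w)) by simpa using H Finset.univ
  intro T
  induction T using Finset.induction_on with
  | empty => simp
  | insert i T hi ih =>
    rw [ih, ← h i _ (w i)]
    congr 1
    funext k
    rcases k with k | k <;> rcases eq_or_ne k i with rfl | hk
    · rw [Function.update_of_ne Sum.inl_ne_inr, Function.update_self, Sum.elim_inl, Sum.elim_inl,
        Finset.piecewise_insert_self, Finset.piecewise_eq_of_notMem _ _ _ hi, Pi.add_apply]
    · rw [Function.update_of_ne Sum.inl_ne_inr, Function.update_of_ne (Sum.inl_injective.ne hk),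
        Sum.elim_inl, Sum.elim_inl, Finset.piecewise_insert, Function.update_of_ne hk]
    · rw [Function.update_self, Sum.elim_inr, Sum.elim_inr, Finset.piecewise_insert_self,
        Finset.piecewise_eq_of_notMem _ _ _ hi, Pi.zero_apply, sub_self]
    · rw [Function.update_of_ne (Sum.inr_injective.ne hk), Function.update_of_ne Sum.inr_ne_inl,
        Sum.elim_inr, Sum.elim_inr, Finset.piecewise_insert, Function.update_of_ne hk]

theorem pairDerivs_add (L : List κ) (f g : (κ ⊕ κ → ℂ) → ℂ) :
    pairDerivs L (f + g) = pairDerivs L f + pairDerivs L g := by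
  induction L generalizing f g with
  | nil => rfl
  | cons i L ih =>
    rw [pairDerivs, pairDerivs, pairDerivs, ← ih]
    congr 1
    simp only [pairDeriv, slopeIn_add]
    abel

theorem slopeIn_smul {ι : Type*} [DecidableEq ι] (i : ι) (c : ℂ) (f : (ι → ℂ) → ℂ) :
    slopeIn i (c • f) = c • slopeIn i f := by
  funext x
  simp [slopeIn, mul_sub]

theorem pairDerivs_smul (L : List κ) (c : ℂ) (f : (κ ⊕ κ → ℂ) → ℂ) :
    pairDerivs L (c • f) = c • pairDerivs L f := by
  induction L generalizing f with
  | nil => rfl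
  | cons i L ih => rw [pairDerivs, pairDerivs, ← ih, pairDeriv, pairDeriv, slopeIn_smul,
      slopeIn_smul, smul_add]

theorem pairDerivs_sum {σ : Type*} (s : Finset σ) (L : List κ) (f : σ → (κ ⊕ κ → ℂ) → ℂ) :
    pairDerivs L (∑ a ∈ s, f a) = ∑ a ∈ s, pairDerivs L (f a) := by
  classical
  induction s using Finset.induction_on with
  | empty =>
    have := pairDerivs_smul L 0 (0 : (κ ⊕ κ → ℂ) → ℂ)
    simpa using this
  | insert a s ha ih => rw [Finset.sum_insert ha, Finset.sum_insert ha, pairDerivs_add, ih]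

/-- The product of a function of the variables `z` and the monomial `w^S`. -/
def mulMonomial (h : (κ → ℂ) → ℂ) (S : Finset κ) : (κ ⊕ κ → ℂ) → ℂ :=
  fun x => h (x ∘ Sum.inl) * ∏ i ∈ S, x (Sum.inr i)

theorem slopeIn_inl_mulMonomial (h : (κ → ℂ) → ℂ) (S : Finset κ) (i : κ) :
    slopeIn (Sum.inl i) (mulMonomial h S) = mulMonomial (slopeIn i h) S := by
  funext x
  simp [slopeIn, mulMonomial, sub_mul]

theorem slopeIn_inr_mulMonomial (h : (κ → ℂ) → ℂ) (S : Finset κ) (i : κ) :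
    slopeIn (Sum.inr i) (mulMonomial h S) =
      if i ∈ S then mulMonomial h (S.erase i) else 0 := by
  funext x
  have e (t : ℂ) : Function.update x (Sum.inr i) t ∘ Sum.inl = x ∘ Sum.inl := by
    funext k; simp
  have p (t : ℂ) (T : Finset κ) (hT : i ∉ T) :
      ∏ k ∈ T, Function.update x (Sum.inr i) t (Sum.inr k) = ∏ k ∈ T, x (Sum.inr k) :=
    Finset.prod_congr rfl fun k hk => by
      rw [Function.update_of_ne (Sum.inr_injective.ne (ne_of_mem_of_not_mem hk hT))]
  split_ifs with hi
  · have hi' := Finset.notMem_erase i S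
    simp only [slopeIn, mulMonomial, e]
    rw [← Finset.mul_prod_erase S _ hi, ← Finset.mul_prod_erase S _ hi, p _ _ hi', p _ _ hi']
    simp
  · simp only [slopeIn, mulMonomial, e, p _ _ hi]
    simp

/-- For a family of functions closed under partial derivatives, the value at `w = 0` of the
differential operator applied to `h(z) w^S`. -/
theorem pairDerivs_mulMonomial {q : Finset κ → (κ → ℂ) → ℂ}
    (hq : ∀ T i, i ∉ T → slopeIn i (q T) = q (insert i T)) {L : List κ} (hL : L.Nodup)
    (T S : Finset κ) (hT : ∀ i ∈ L, i ∉ T) (z : κ → ℂ) :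
    pairDerivs L (mulMonomial (q T) S) (Sum.elim z 0) =
      if S ⊆ L.toFinset then q (T ∪ (L.toFinset \ S)) z else 0 := by
  induction L generalizing T S with
  | nil =>
    rcases S.eq_empty_or_nonempty with rfl | hS
    · simp [pairDerivs, mulMonomial]
    · obtain ⟨k, hk⟩ := hS
      have : ¬ S ⊆ ([] : List κ).toFinset := fun h => by simpa using h hk
      rw [if_neg this, pairDerivs, mulMonomial, Finset.prod_eq_zero hk (by simp), mul_zero]
  | cons i L ih =>
    obtain ⟨hiL, hL⟩ := List.nodup_cons.1 hL
    have hiT := hT i List.mem_cons_self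
    have h1 := ih hL (insert i T) S fun j hj hjT => by
      rcases Finset.mem_insert.1 hjT with rfl | h
      · exact hiL hj
      · exact hT j (List.mem_cons_of_mem _ hj) h
    have h2 := ih hL T (S.erase i) fun j hj => hT j (List.mem_cons_of_mem _ hj)
    have hiL' : i ∉ L.toFinset := by simpa using hiL
    rw [pairDerivs, pairDeriv, slopeIn_inl_mulMonomial, slopeIn_inr_mulMonomial, hq T i hiT,
      pairDerivs_add, Pi.add_apply, h1, List.toFinset_cons]
    by_cases hi : i ∈ S
    · rw [if_pos hi, h2, if_neg fun h => hiL' (h hi), zero_add]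
      refine if_congr Finset.subset_insert_iff.symm ?_ rfl
      congr 1
      grind
    · rw [if_neg hi]
      have h0 : pairDerivs L (0 : (κ ⊕ κ → ℂ) → ℂ) = 0 := by
        simpa using pairDerivs_smul L 0 (0 : (κ ⊕ κ → ℂ) → ℂ)
      rw [h0, Pi.zero_apply, add_zero]
      refine if_congr (Finset.subset_insert_iff_of_notMem hi).symm ?_ rfl
      congr 1
      grind

end PairDerivative

/-! ### The stable polynomial `det(diag(z) - A)` and its partial derivatives -/

section Determinant

variable {κ : Type*} [DecidableEq κ]

/-- The matrix `diag(z) - A` with the rows in `T` replaced by those of the identity matrix. -/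
def borderedMatrix (A : Matrix κ κ ℂ) (T : Finset κ) (z : κ → ℂ) : Matrix κ κ ℂ :=
  Matrix.of fun i => if i ∈ T then Pi.single i 1 else Pi.single i (z i) - A i

theorem borderedMatrix_update (A : Matrix κ κ ℂ) {T : Finset κ} {i : κ} (hi : i ∉ T)
    (z : κ → ℂ) (t : ℂ) : borderedMatrix A T (Function.update z i t) =
      (borderedMatrix A T z).updateRow i (t • Pi.single i 1 + -A i) := by
  ext j k
  rcases eq_or_ne j i with rfl | h
  · simp [borderedMatrix, hi, Pi.single_apply, sub_eq_add_neg]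
  · simp [borderedMatrix, h]

theorem borderedMatrix_insert (A : Matrix κ κ ℂ) (T : Finset κ) (i : κ) (z : κ → ℂ) :
    borderedMatrix A (insert i T) z = (borderedMatrix A T z).updateRow i (Pi.single i 1) := by
  ext j k
  rcases eq_or_ne j i with rfl | h
  · simp [borderedMatrix]
  · simp [borderedMatrix, h]

theorem borderedMatrix_empty (A : Matrix κ κ ℂ) (z : κ → ℂ) :
    borderedMatrix A ∅ z = Matrix.diagonal z - A := by
  ext i j
  rcases eq_or_ne i j with rfl | h
  · simp [borderedMatrix]
  · simp [borderedMatrix, h, h.symm]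

variable [Fintype κ]

/-- The partial derivative of `det (diag(z) - A)` with respect to the variables in `T`. -/
def borderedDet (A : Matrix κ κ ℂ) (T : Finset κ) (z : κ → ℂ) : ℂ :=
  (borderedMatrix A T z).det

theorem borderedDet_update (A : Matrix κ κ ℂ) {T : Finset κ} {i : κ} (hi : i ∉ T)
    (z : κ → ℂ) (t : ℂ) : borderedDet A T (Function.update z i t) =
      t * borderedDet A (insert i T) z + ((borderedMatrix A T z).updateRow i (-A i)).det := by
  rw [borderedDet, borderedMatrix_update A hi, Matrix.det_updateRow_add,
    Matrix.det_updateRow_smul, borderedDet, borderedMatrix_insert]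

theorem slopeIn_borderedDet (A : Matrix κ κ ℂ) (T : Finset κ) (i : κ) (hi : i ∉ T) :
    slopeIn i (borderedDet A T) = borderedDet A (insert i T) := by
  funext z
  rw [slopeIn, borderedDet_update A hi, borderedDet_update A hi]
  ring

theorem multiAffine_borderedDet (A : Matrix κ κ ℂ) : MultiAffine (borderedDet A ∅) := by
  intro i z t
  have hi := Finset.notMem_empty i
  rw [slopeIn_borderedDet A ∅ i hi, borderedDet_update A hi, borderedDet_update A hi]
  ring

theorem realMultiAffine_borderedDet {A : Matrix κ κ ℂ} (hA : A.IsHermitian) :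
    RealMultiAffine (borderedDet A ∅) where
  affine := multiAffine_borderedDet A
  cont := by
    have h (z : κ → ℂ) : borderedDet A ∅ z = (Matrix.diagonal z - A).det := by
      rw [borderedDet, borderedMatrix_empty]
    rw [funext h]
    exact (continuous_id.matrix_diagonal.sub continuous_const).matrix_det
  real x := by
    rw [borderedDet, borderedMatrix_empty]
    have hM : (Matrix.diagonal (fun i => (x i : ℂ)) - A).IsHermitian := by
      refine Matrix.IsHermitian.sub ?_ hA
      rw [Matrix.IsHermitian, Matrix.diagonal_conjTranspose]
      congr 1
      funext i
      simp
    have h := Matrix.det_conjTranspose (Matrix.diagonal (fun i => (x i : ℂ)) - A)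
    rw [hM.eq] at h
    exact Complex.conj_eq_iff_im.1 h.symm

/-- A kernel vector `v` vanishes on `T` and satisfies `z_i v_i = (A v)_i` elsewhere. As `v* A v` is
real, `∑ Im(z_i) |v_i|² = 0`, so `v = 0`. -/
theorem nonvanishing_borderedDet {A : Matrix κ κ ℂ} (hA : A.IsHermitian) (T : Finset κ) :
    NonvanishingOnUpper (borderedDet A T) := by
  intro z hz hdet
  obtain ⟨v, hv, hMv⟩ := Matrix.exists_mulVec_eq_zero_iff.2 hdet
  have hT (i : κ) (hi : i ∈ T) : v i = 0 := by
    have := congrFun hMv i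
    simpa [borderedMatrix, Matrix.mulVec, hi] using this
  have hrow (i : κ) (hi : i ∉ T) : z i * v i = A.mulVec v i := by
    have h : (if i ∈ T then Pi.single i 1 else Pi.single i (z i) - A i) ⬝ᵥ v = 0 :=
      congrFun hMv i
    rwa [if_neg hi, sub_dotProduct, single_dotProduct, sub_eq_zero] at h
  have hsum : ∑ i, star (v i) * (z i * v i) = star v ⬝ᵥ A.mulVec v := by
    refine Finset.sum_congr rfl fun i _ => ?_
    by_cases hi : i ∈ T
    · simp [hT i hi]
    · rw [hrow i hi]; rfl
  have him : (∑ i, star (v i) * (z i * v i)).im = ∑ i, (z i).im * Complex.normSq (v i) := by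
    rw [Complex.im_sum]
    refine Finset.sum_congr rfl fun i _ => ?_
    simp [Complex.normSq_apply]
    ring
  have hzero : (star v ⬝ᵥ A.mulVec v).im = 0 := hA.im_star_dotProduct_mulVec_self v
  rw [← hsum, him] at hzero
  have h0 := (Finset.sum_eq_zero_iff_of_nonneg fun i _ =>
    mul_nonneg (hz i).le (Complex.normSq_nonneg (v i))).1 hzero
  refine hv (funext fun i => ?_)
  have := (mul_eq_zero.1 (h0 i (Finset.mem_univ i))).resolve_left (hz i).ne'
  exact Complex.normSq_eq_zero.1 this

theorem borderedDet_compl (A : Matrix κ κ ℂ) (S : Finset κ) (x : ℂ) :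
    borderedDet A Sᶜ (fun _ => x) =
      ((A.submatrix Subtype.val Subtype.val : Matrix S S ℂ).charpoly).eval x := by
  rw [Matrix.eval_charpoly, borderedDet,
    Matrix.twoBlockTriangular_det (borderedMatrix A Sᶜ fun _ => x) (· ∈ S) ?_]
  · have h1 : (borderedMatrix A Sᶜ fun _ => x).toSquareBlockProp (fun i => ¬ i ∈ S) = 1 := by
      ext i j
      have hi : (i : κ) ∉ S := i.2
      simp [borderedMatrix, Matrix.toSquareBlockProp_def, hi, Matrix.one_apply, Pi.single_apply,
        Subtype.ext_iff, eq_comm]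
    have h2 : (borderedMatrix A Sᶜ fun _ => x).toSquareBlockProp (fun i => i ∈ S) =
        Matrix.scalar {i // i ∈ S} x - A.submatrix Subtype.val Subtype.val := by
      ext i j
      have hi : (i : κ) ∉ Sᶜ := by simp
      rw [Matrix.sub_apply, Matrix.scalar_apply, Matrix.diagonal_apply]
      change (if (i : κ) ∈ Sᶜ then Pi.single (i : κ) (1 : ℂ) else Pi.single (i : κ) x - A i) j = _
      rw [if_neg hi, Pi.sub_apply, Pi.single_apply]
      rcases eq_or_ne i j with rfl | h
      · rw [if_pos rfl, if_pos rfl]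
        rfl
      · rw [if_neg (Subtype.coe_injective.ne h.symm), if_neg h]
        rfl
    rw [h1, Matrix.det_one, mul_one, h2]
    convert rfl
  · intro i hi j hj
    have : j ≠ i := fun h => hi (h ▸ hj)
    simp [borderedMatrix, hi, this]

end Determinant

/-! ### Generating functions of weights and the mixed characteristic polynomial -/

section WeightPoly

variable {κ : Type*} [DecidableEq κ]

theorem prod_update_eq (w : κ → ℂ) (i : κ) (t : ℂ) (S : Finset κ) :
    ∏ k ∈ S, Function.update w i t k =
      (if i ∈ S then t else 1) * ∏ k ∈ S.erase i, w k := by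
  have h (T : Finset κ) (hT : i ∉ T) : ∏ k ∈ T, Function.update w i t k = ∏ k ∈ T, w k :=
    Finset.prod_congr rfl fun k hk => Function.update_of_ne (ne_of_mem_of_not_mem hk hT) _ _
  split_ifs with hi
  · rw [← Finset.mul_prod_erase S _ hi, h _ (Finset.notMem_erase i S), Function.update_self]
  · rw [h _ hi, Finset.erase_eq_of_notMem hi, one_mul]

/-- The product of a function of `z` and a function of `w`. -/
def tensorMul (h g : (κ → ℂ) → ℂ) : (κ ⊕ κ → ℂ) → ℂ :=
  fun x => h (x ∘ Sum.inl) * g (x ∘ Sum.inr)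

theorem slopeIn_inl_tensorMul (h g : (κ → ℂ) → ℂ) (i : κ) :
    slopeIn (Sum.inl i) (tensorMul h g) = tensorMul (slopeIn i h) g := by
  funext x
  simp [slopeIn, tensorMul, sub_mul]

theorem slopeIn_inr_tensorMul (h g : (κ → ℂ) → ℂ) (i : κ) :
    slopeIn (Sum.inr i) (tensorMul h g) = tensorMul h (slopeIn i g) := by
  funext x
  simp [slopeIn, tensorMul, mul_sub]

theorem RealMultiAffine.tensorMul {h g : (κ → ℂ) → ℂ} (hh : RealMultiAffine h)
    (hg : RealMultiAffine g) : RealMultiAffine (tensorMul h g) where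
  affine := by
    rintro (i | i) x t
    · rw [slopeIn_inl_tensorMul]
      simp only [_root_.tensorMul, Sum.update_inl_comp_inl, Sum.update_inl_comp_inr]
      rw [hh.affine]
      ring
    · rw [slopeIn_inr_tensorMul]
      simp only [_root_.tensorMul, Sum.update_inr_comp_inl, Sum.update_inr_comp_inr]
      rw [hg.affine]
      ring
  cont := (hh.cont.comp (by fun_prop)).mul (hg.cont.comp (by fun_prop))
  real x := by
    have h1 := hh.real (x ∘ Sum.inl)
    have h2 := hg.real (x ∘ Sum.inr)
    change ((h fun i => (x (Sum.inl i) : ℂ)) * (g fun i => (x (Sum.inr i) : ℂ))).im = 0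
    simp only [Function.comp_apply] at h1 h2
    rw [Complex.mul_im, h1, h2]
    simp

variable [Fintype κ]

/-- The function `∑ S, m(S) w^S`. -/
def weightPoly (m : Finset κ → ℝ) (w : κ → ℂ) : ℂ :=
  ∑ S, (m S : ℂ) * ∏ i ∈ S, w i

theorem realMultiAffine_weightPoly (m : Finset κ → ℝ) : RealMultiAffine (weightPoly m) where
  affine i x t := by
    simp only [weightPoly, slopeIn, prod_update_eq, ← Finset.sum_sub_distrib, Finset.mul_sum,
      ← Finset.sum_add_distrib]
    refine Finset.sum_congr rfl fun S _ => ?_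
    split_ifs <;> ring
  cont := by unfold weightPoly; fun_prop
  real x := by
    have : weightPoly m (fun i => (x i : ℂ)) = ((∑ S, m S * ∏ i ∈ S, x i : ℝ) : ℂ) := by
      simp [weightPoly]
    rw [this, Complex.ofReal_im]

theorem stableChain_tensorMul {A : Matrix κ κ ℂ} (hA : A.IsHermitian) {g : (κ → ℂ) → ℂ}
    (hg : NonvanishingOnUpper g) {L : List κ} (hL : L.Nodup) (T : Finset κ)
    (hT : ∀ i ∈ L, i ∉ T) : StableChain L (tensorMul (borderedDet A T) g) := by
  induction L generalizing T with
  | nil =>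
    exact fun x hx => mul_ne_zero (nonvanishing_borderedDet hA T _ fun i => hx _)
      (hg _ fun i => hx _)
  | cons i L ih =>
    obtain ⟨hiL, hL⟩ := List.nodup_cons.1 hL
    refine ⟨ih hL T fun j hj => hT j (List.mem_cons_of_mem _ hj), ?_⟩
    rw [slopeIn_inl_tensorMul, slopeIn_borderedDet A T i (hT i List.mem_cons_self)]
    refine ih hL _ fun j hj hjT => ?_
    rcases Finset.mem_insert.1 hjT with rfl | h
    · exact hiL hj
    · exact hT j (List.mem_cons_of_mem _ hj) h

theorem pairDerivs_tensorMul {A : Matrix κ κ ℂ} (hA : A.IsHermitian) (m : Finset κ → ℝ)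
    (z w : κ → ℂ) : pairDerivs Finset.univ.toList (tensorMul (borderedDet A ∅) (weightPoly m))
      (Sum.elim z w) = ∑ S, (m S : ℂ) * borderedDet A Sᶜ (z + w) := by
  have hnd := Finset.nodup_toList (Finset.univ : Finset κ)
  have hma := ((realMultiAffine_borderedDet hA).tensorMul (realMultiAffine_weightPoly m)).affine
  rw [eq_of_dependsOnSum fun i => hma.dependsOnSum_pairDerivs hnd (by simp)]
  have hsum : tensorMul (borderedDet A ∅) (weightPoly m) =
      ∑ S, (m S : ℂ) • mulMonomial (borderedDet A ∅) S := by
    funext x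
    simp only [tensorMul, weightPoly, mulMonomial, Finset.sum_apply, Pi.smul_apply, smul_eq_mul,
      Finset.mul_sum, Function.comp_apply]
    exact Finset.sum_congr rfl fun S _ => by ring
  rw [hsum, pairDerivs_sum, Finset.sum_apply]
  refine Finset.sum_congr rfl fun S _ => ?_
  rw [pairDerivs_smul, Pi.smul_apply,
    pairDerivs_mulMonomial (slopeIn_borderedDet A) hnd ∅ S (by simp)]
  simp [Finset.compl_eq_univ_sdiff]

/-- The mixture of the characteristic polynomials of the principal submatrices of `A`. -/
noncomputable def mixedCharpoly (A : Matrix κ κ ℂ) (m : Finset κ → ℝ) (x : ℂ) : ℂ :=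
  ∑ S : Finset κ, (m S : ℂ) *
    ((A.submatrix Subtype.val Subtype.val : Matrix S S ℂ).charpoly).eval x

theorem pairDerivs_tensorMul_const {A : Matrix κ κ ℂ} (hA : A.IsHermitian) (m : Finset κ → ℝ)
    (x y : ℂ) : pairDerivs Finset.univ.toList (tensorMul (borderedDet A ∅) (weightPoly m))
      (Sum.elim (fun _ => x) (fun _ => y)) = mixedCharpoly A m (x + y) := by
  rw [pairDerivs_tensorMul hA, mixedCharpoly]
  exact Finset.sum_congr rfl fun S _ => by rw [← borderedDet_compl]; rfl

theorem mixedCharpoly_ne_zero {A : Matrix κ κ ℂ} (hA : A.IsHermitian) {m : Finset κ → ℝ}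
    (hm : NonvanishingOnUpper (weightPoly m)) {x : ℂ} (hx : 0 < x.im) :
    mixedCharpoly A m x ≠ 0 := by
  have h := (stableChain_tensorMul hA hm (Finset.nodup_toList Finset.univ) ∅
    (by simp)).pairDerivs
    ((realMultiAffine_borderedDet hA).tensorMul (realMultiAffine_weightPoly m))
    (Sum.elim (fun _ => x / 2) (fun _ => x / 2)) (by
      have : 0 < (x / 2).im := by rw [Complex.div_ofNat_im]; linarith
      rintro (i | i) <;> simpa using this)
  rwa [pairDerivs_tensorMul_const hA, add_halves] at h

/-- The barrier bound for mixed characteristic polynomials. -/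
theorem mixedCharpoly_pos {A : Matrix κ κ ℂ} (hA : A.IsHermitian) {m : Finset κ → ℝ}
    (hm : NonvanishingOnUpper (weightPoly m)) {a b x y : ℝ} (ha : 0 < a) (hb : 0 < b)
    (hdet : ∀ z : κ → ℝ, (∀ i, x ≤ z i) → 0 < realValue (borderedDet A ∅) z)
    (hdet_le : ∀ i, realValue (borderedDet A {i}) (fun _ => x) ≤
      a * realValue (borderedDet A ∅) fun _ => x)
    (hpoly : ∀ w : κ → ℝ, (∀ i, y ≤ w i) → 0 < realValue (weightPoly m) w)
    (hpoly_le : ∀ i, realValue (slopeIn i (weightPoly m)) (fun _ => y) ≤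
      b * realValue (weightPoly m) fun _ => y)
    {s : ℝ} (hs : x + y - 1 / (a + b) ≤ s) : 0 < (mixedCharpoly A m s).re := by
  have hq := realMultiAffine_borderedDet hA
  have hp := realMultiAffine_weightPoly m
  have hf := hq.tensorMul hp
  have hchain := stableChain_tensorMul hA hm (Finset.nodup_toList Finset.univ) ∅ (by simp)
  set X : κ ⊕ κ → ℝ := Sum.elim (fun _ => x) (fun _ => y) with hX
  have hval {h g : (κ → ℂ) → ℂ} (hh : RealMultiAffine h) (Y : κ ⊕ κ → ℝ) :
      realValue (tensorMul h g) Y = realValue h (Y ∘ Sum.inl) * realValue g (Y ∘ Sum.inr) := by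
    have := hh.real (Y ∘ Sum.inl)
    change ((h fun i => (Y (Sum.inl i) : ℂ)) * (g fun i => (Y (Sum.inr i) : ℂ))).re = _
    simp only [Function.comp_apply] at this
    rw [Complex.mul_re, this, zero_mul, sub_zero]
    rfl
  have hpos (Y : κ ⊕ κ → ℝ) (hY : X ≤ Y) :
      0 < realValue (tensorMul (borderedDet A ∅) (weightPoly m)) Y := by
    rw [hval hq]
    exact mul_pos (hdet _ fun i => hY (Sum.inl i)) (hpoly _ fun i => hY (Sum.inr i))
  have hB : Barrier a b Finset.univ.toList
      (tensorMul (borderedDet A ∅) (weightPoly m)) X := by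
    refine ⟨hpos, fun Y hY j _ => realValue_slopeIn_le_of_le hf hchain.nonvanishing hpos ha.le
      ?_ hY, fun Y hY j _ => realValue_slopeIn_le_of_le hf hchain.nonvanishing hpos hb.le ?_ hY⟩
    · rw [slopeIn_inl_tensorMul, hval (hq.slopeIn j), hval hq, ← mul_assoc,
        slopeIn_borderedDet A ∅ j (by simp)]
      exact mul_le_mul_of_nonneg_right (hdet_le j) (hpoly _ fun i => le_rfl).le
    · rw [slopeIn_inr_tensorMul, hval hq, hval hq, mul_left_comm]
      exact mul_le_mul_of_nonneg_left (hpoly_le j) (hdet _ fun i => le_rfl).le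
  -- Every `w_i` may be lowered to `y - 1 / (a + b)`, which is at most `s - x`; the point `(x, s -
  -- x)` evaluates the mixture at `s`.
  have := hB.pairDerivs_pos hf hchain (Finset.nodup_toList _) ha hb
    (Y := Sum.elim (fun _ => x) (fun _ => s - x)) (fun i => le_rfl) (fun i => by
      simp only [Finset.mem_toList, Finset.mem_univ, if_true, hX, Sum.elim_inr]
      linarith)
  have e : (fun i => ((Sum.elim (fun _ => x) (fun _ => s - x) : κ ⊕ κ → ℝ) i : ℂ)) =
      Sum.elim (fun _ => (x : ℂ)) (fun _ => ((s - x : ℝ) : ℂ)) := by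
    funext i
    rcases i with i | i <;> rfl
  rw [realValue, e, pairDerivs_tensorMul_const hA] at this
  simpa using this

end WeightPoly

/-! ### Real-rooted pencils and positivity on a half line -/

section Interlacing

open Polynomial

/-- All roots are real and negative, so `p` is a positive constant times factors `X - x` with `x <
0`. -/
theorem coeff_pos_of_real_roots_neg (d : ℕ) (p : ℝ[X]) (hd : p.natDegree = d)
    (hlead : 0 < p.coeff d) (hroots : ∀ z : ℂ, aeval z p = 0 → z.im = 0)
    (hpos : ∀ x : ℝ, 0 ≤ x → 0 < p.eval x) (k : ℕ) (hk : k ≤ d) : 0 < p.coeff k := by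
  induction d generalizing p k with
  | zero => rwa [Nat.le_zero.1 hk]
  | succ d ih =>
    have hp0 : p ≠ 0 := fun h => by simp [h] at hlead
    obtain ⟨z, hz⟩ := IsAlgClosed.exists_aeval_eq_zero ℂ p (by
      rw [degree_eq_natDegree hp0, hd]
      exact_mod_cast d.succ_ne_zero)
    obtain ⟨x, rfl⟩ : ∃ x : ℝ, (x : ℂ) = z := ⟨z.re, Complex.ext rfl (hroots z hz).symm⟩
    have hx : p.IsRoot x := by
      have h : aeval ((algebraMap ℝ ℂ) x) p = 0 := hz
      rw [aeval_algebraMap_apply] at h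
      simpa using h
    have hx0 : x < 0 := by
      by_contra! h
      exact (hpos x h).ne' hx
    obtain ⟨q, rfl⟩ := dvd_iff_isRoot.2 hx
    have hq0 : q ≠ 0 := right_ne_zero_of_mul hp0
    have hqd : q.natDegree = d := by
      rw [natDegree_mul (X_sub_C_ne_zero x) hq0, natDegree_X_sub_C] at hd
      omega
    have hc (j : ℕ) : ((X - C x) * q).coeff (j + 1) = q.coeff j - x * q.coeff (j + 1) := by
      rw [sub_mul, coeff_sub, coeff_X_mul, coeff_C_mul]
    have hqlead : 0 < q.coeff d := by
      rw [hc, coeff_eq_zero_of_natDegree_lt (n := d + 1) (by omega)] at hlead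
      simpa using hlead
    have hq := ih q hqd hqlead (fun z hz => hroots z (by rw [map_mul, hz, mul_zero]))
      (fun y hy => by
        have := hpos y hy
        rw [eval_mul, eval_sub, eval_X, eval_C] at this
        exact pos_of_mul_pos_right this (by linarith))
    rcases k with _ | j
    · rw [mul_coeff_zero, coeff_sub, coeff_X_zero, coeff_C_zero, zero_sub]
      exact mul_pos (neg_pos.2 hx0) (hq 0 (Nat.zero_le _))
    · rw [hc]
      have h1 := hq j (by omega)
      have h2 : 0 ≤ q.coeff (j + 1) := by
        rcases Nat.lt_or_ge d (j + 1) with h | h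
        · rw [coeff_eq_zero_of_natDegree_lt (by omega)]
        · exact (hq _ h).le
      nlinarith

theorem eval_pos_of_coeff_nonneg {p : ℝ[X]} (h : ∀ k, 0 ≤ p.coeff k) (h0 : 0 < p.coeff 0)
    {x : ℝ} (hx : 0 ≤ x) : 0 < p.eval x := by
  rw [eval_eq_sum_range]
  refine Finset.sum_pos' (fun k _ => mul_nonneg (h k) (pow_nonneg hx k)) ⟨0, by simp, ?_⟩
  simpa using h0

/-- It suffices that `g` has no negative coefficient. Otherwise take the largest `s` at which a
coefficient negative in `g` vanishes in `s f + g`; then `0 < s < 1`. The remaining coefficients are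
nonnegative and the constant one positive, so `s f + g` is positive on `[0, ∞)`. Being real rooted
it has only positive coefficients, contradicting the zero one. -/
theorem eval_pos_of_interlacing_zero {d : ℕ} {f g : ℝ[X]} (hf : f.natDegree ≤ d)
    (hg : g.natDegree ≤ d) (hfd : 0 < f.coeff d) (hgd : 0 < g.coeff d)
    (hroots : ∀ s : ℝ, 0 < s → ∀ z : ℂ, aeval z (C s * f + g) = 0 → z.im = 0)
    (hpos : ∀ x : ℝ, 0 ≤ x → 0 < (f + g).eval x) (hg0 : 0 < g.eval 0) {x : ℝ} (hx : 0 ≤ x) :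
    0 < g.eval x := by
  have hnd (s : ℝ) (hs : 0 < s) : (C s * f + g).natDegree = d ∧ 0 < (C s * f + g).coeff d := by
    have h1 : 0 < (C s * f + g).coeff d := by
      rw [coeff_add, coeff_C_mul]
      positivity
    refine ⟨le_antisymm ?_ (le_natDegree_of_ne_zero h1.ne'), h1⟩
    exact natDegree_add_le_of_degree_le ((natDegree_C_mul_le _ _).trans hf) hg
  have hzero (k : ℕ) (hk : d < k) : f.coeff k = 0 ∧ g.coeff k = 0 :=
    ⟨coeff_eq_zero_of_natDegree_lt (by omega), coeff_eq_zero_of_natDegree_lt (by omega)⟩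
  have hone (k : ℕ) (hk : k ≤ d) : 0 < f.coeff k + g.coeff k := by
    have h := hnd 1 one_pos
    rw [← coeff_add]
    simpa using coeff_pos_of_real_roots_neg d _ h.1 h.2 (hroots 1 one_pos)
      (by simpa using hpos) k hk
  have hg0' : 0 < g.coeff 0 := by rwa [coeff_zero_eq_eval_zero]
  refine eval_pos_of_coeff_nonneg (fun k => ?_) hg0' hx
  by_contra! hneg
  have hkd : k ≤ d := by
    by_contra! h
    rw [(hzero k h).2] at hneg
    exact hneg.false
  -- the largest parameter at which some coefficient of `s f + g` vanishes
  obtain ⟨k, hk, hmax⟩ := Finset.exists_max_image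
    ((Finset.range (d + 1)).filter fun k => g.coeff k < 0) (fun k => -g.coeff k / f.coeff k)
    ⟨k, by simp [hneg]; omega⟩
  simp only [Finset.mem_filter, Finset.mem_range] at hk hmax
  have hfpos (j : ℕ) (hj : j ≤ d) (hgj : g.coeff j < 0) : 0 < f.coeff j := by
    linarith [hone j hj]
  have hkd : k ≤ d := by omega
  have hfk := hfpos k hkd hk.2
  set s := -g.coeff k / f.coeff k with hs
  have hs0 : 0 < s := div_pos (neg_pos.2 hk.2) hfk
  have hs1 : s < 1 := by rw [hs, div_lt_one hfk]; linarith [hone k hkd]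
  have hsk : s * f.coeff k = -g.coeff k := div_mul_cancel₀ _ hfk.ne'
  have hnonneg (j : ℕ) : 0 ≤ (C s * f + g).coeff j := by
    rw [coeff_add, coeff_C_mul]
    rcases Nat.lt_or_ge d j with h | h
    · rw [(hzero j h).1, (hzero j h).2]; simp
    rcases lt_or_ge (g.coeff j) 0 with hj | hj
    · have h1 := hmax j ⟨by omega, hj⟩
      rw [div_le_iff₀ (hfpos j h hj)] at h1
      linarith
    · have := hone j h
      nlinarith
  have h0 : 0 < (C s * f + g).coeff 0 := by
    rw [coeff_add, coeff_C_mul]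
    have := hone 0 (Nat.zero_le _)
    nlinarith
  have h := coeff_pos_of_real_roots_neg d _ (hnd s hs0).1 (hnd s hs0).2 (hroots s hs0)
    (fun x hx => eval_pos_of_coeff_nonneg hnonneg h0 hx) k hkd
  rw [coeff_add, coeff_C_mul, hsk, neg_add_cancel] at h
  exact h.false

theorem coeff_comp_X_add_C_natDegree {d : ℕ} {f : ℝ[X]} (hf : f.natDegree ≤ d)
    (hfd : 0 < f.coeff d) (c : ℝ) :
    (f.comp (X + C c)).natDegree ≤ d ∧ 0 < (f.comp (X + C c)).coeff d := by
  have hd : f.natDegree = d := le_antisymm hf (le_natDegree_of_ne_zero hfd.ne')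
  have h1 : (f.comp (X + C c)).natDegree = d := by
    rw [natDegree_comp, natDegree_X_add_C, hd, mul_one]
  refine ⟨h1.le, ?_⟩
  have h2 := leadingCoeff_comp (p := f) (q := X + C c) (by simp)
  rw [leadingCoeff, h1] at h2
  rw [h2]
  simpa [leadingCoeff, hd] using hfd

/-- If all the positive combinations of `f` and `g` are real rooted, then one of them has its
largest root at most that of `f + g`. -/
theorem eval_pos_or_of_interlacing {d : ℕ} {f g : ℝ[X]} (hf : f.natDegree ≤ d)
    (hg : g.natDegree ≤ d) (hfd : 0 < f.coeff d) (hgd : 0 < g.coeff d)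
    (hroots : ∀ s t : ℝ, 0 < s → 0 < t → ∀ z : ℂ, aeval z (C s * f + C t * g) = 0 → z.im = 0)
    {c : ℝ} (hpos : ∀ x : ℝ, c ≤ x → 0 < (f + g).eval x) :
    (∀ x, c ≤ x → 0 < f.eval x) ∨ ∀ x, c ≤ x → 0 < g.eval x := by
  -- `f + g` is positive at `c`, so at least one summand is.
  wlog hgc : 0 < g.eval c generalizing f g
  · refine (this hg hf hgd hfd (fun s t hs ht z hz => hroots t s ht hs z (by rwa [add_comm]))
      (by rwa [add_comm]) ?_).symm
    have := hpos c le_rfl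
    rw [eval_add] at this
    linarith
  right
  obtain ⟨hf1, hf2⟩ := coeff_comp_X_add_C_natDegree hf hfd c
  obtain ⟨hg1, hg2⟩ := coeff_comp_X_add_C_natDegree hg hgd c
  intro x hx
  have := eval_pos_of_interlacing_zero hf1 hg1 hf2 hg2 (fun s hs z hz => ?_) (fun y hy => ?_)
    (by simpa using hgc) (sub_nonneg.2 hx)
  · simpa using this
  · have := hroots s 1 hs one_pos (z + c) (by simpa [aeval_comp] using hz)
    simpa using this
  · simpa using hpos (y + c) (by linarith)

end Interlacing

/-! ### Stable homogeneous weights and conditioning on one element -/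

section Conditioning

theorem weightPoly_const {κ : Type*} [Fintype κ] {d : ℕ} {m : Finset κ → ℝ}
    (hm : ∀ S, m S ≠ 0 → S.card = d) (x : ℂ) :
    weightPoly m (fun _ => x) = (∑ S, m S : ℝ) * x ^ d := by
  rw [weightPoly, Complex.ofReal_sum, Finset.sum_mul]
  refine Finset.sum_congr rfl fun S _ => ?_
  rcases eq_or_ne (m S) 0 with h | h
  · simp [h]
  · rw [Finset.prod_const, hm S h]

variable {κ : Type*} [DecidableEq κ]

/-- If `g` vanished at `x` with nonzero slope, then for `u = I / η` with small `η` the equation `k +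
u g = 0` could be solved by a small move `t η` of the `j`-th variable. This replaces Hurwitz's
theorem. -/
theorem eq_zero_of_nonvanishing_pencil_line {g k : (κ → ℂ) → ℂ} (hg : MultiAffine g)
    (hk : MultiAffine k)
    (h : ∀ x : κ → ℂ, (∀ i, 0 < (x i).im) → ∀ u : ℂ, 0 < u.im → k x + u * g x ≠ 0)
    {x : κ → ℂ} (hx : ∀ i, 0 < (x i).im) (h0 : g x = 0) (j : κ) : slopeIn j g x = 0 := by
  by_contra ha
  set a := slopeIn j g x with ha'
  set b := k x with hb
  set c := slopeIn j k x with hc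
  let t : ℝ → ℂ := fun η => -(b * η) / (a * Complex.I + c * η)
  have hden0 : a * Complex.I + c * ((0 : ℝ) : ℂ) ≠ 0 := by simp [ha]
  have hden : Continuous fun η : ℝ => a * Complex.I + c * η := by fun_prop
  have hnum : Continuous fun η : ℝ => -(b * η) := by fun_prop
  have hcont : ContinuousAt (fun η => (x j + t η).im) 0 :=
    Complex.continuous_im.continuousAt.comp
      (continuousAt_const.add (hnum.continuousAt.div hden.continuousAt hden0))
  have him0 : 0 < (x j + t 0).im := by simpa [t] using hx j
  have hev := (hcont.eventually (lt_mem_nhds him0)).and (hden.continuousAt.eventually_ne hden0)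
  obtain ⟨η, ⟨him, hne⟩, hη⟩ :=
    ((hev.filter_mono nhdsWithin_le_nhds).and (self_mem_nhdsWithin (s := Set.Ioi (0 : ℝ)))).exists
  replace hη : 0 < η := hη
  have hη' : (η : ℂ) ≠ 0 := by exact_mod_cast hη.ne'
  refine h (Function.update x j (x j + t η)) (fun i => ?_) (Complex.I * (η⁻¹ : ℝ)) ?_ ?_
  · rcases eq_or_ne i j with rfl | hij
    · simpa using him
    · simpa [hij] using hx i
  · simpa using hη
  · rw [hg.shift, hk.shift, h0]
    have ht : t η * (a * Complex.I + c * η) = -(b * η) := div_mul_cancel₀ _ hne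
    rw [Complex.ofReal_inv, ← mul_right_inj' hη', mul_zero]
    have : (η : ℂ) * (b + t η * c + Complex.I * (η : ℂ)⁻¹ * (0 + t η * a)) =
        b * η + t η * c * η + (η * (η : ℂ)⁻¹) * (Complex.I * t η * a) := by ring
    rw [this, mul_inv_cancel₀ hη']
    linear_combination ht

/-- A function `g` such that `k + u g` has no zeros for `u` and all variables in the upper half
plane is either without zeros or identically zero there. -/
theorem eq_zero_of_nonvanishing_pencil [Fintype κ] {g k : (κ → ℂ) → ℂ} (hg : MultiAffine g)
    (hk : MultiAffine k)
    (h : ∀ x : κ → ℂ, (∀ i, 0 < (x i).im) → ∀ u : ℂ, 0 < u.im → k x + u * g x ≠ 0)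
    {x y : κ → ℂ} (hx : ∀ i, 0 < (x i).im) (hy : ∀ i, 0 < (y i).im) (h0 : g x = 0) :
    g y = 0 := by
  suffices H : ∀ T : Finset κ, g (T.piecewise y x) = 0 by simpa using H Finset.univ
  intro T
  induction T using Finset.induction_on with
  | empty => simpa using h0
  | insert i T hi ih =>
    have hT (j : κ) : 0 < (T.piecewise y x j).im := by
      by_cases hj : j ∈ T
      · simpa [hj] using hy j
      · simpa [hj] using hx j
    have := hg.shift i (T.piecewise y x) (y i - T.piecewise y x i)
    rw [add_sub_cancel, ih, eq_zero_of_nonvanishing_pencil_line hg hk h hT ih i] at this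
    rw [Finset.piecewise_insert, this]
    simp

/-- The restriction of a weight to the sets that contain `i`. -/
def weightIn (i : κ) (m : Finset κ → ℝ) (S : Finset κ) : ℝ := if i ∈ S then m S else 0

/-- The restriction of a weight to the sets that do not contain `i`. -/
def weightOut (i : κ) (m : Finset κ → ℝ) (S : Finset κ) : ℝ := if i ∈ S then 0 else m S

variable [Fintype κ]

theorem weightPoly_weightOut (i : κ) (m : Finset κ → ℝ) (w : κ → ℂ) :
    weightPoly (weightOut i m) w = weightPoly m (Function.update w i 0) := by
  simp only [weightPoly, prod_update_eq, weightOut]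
  refine Finset.sum_congr rfl fun S _ => ?_
  split_ifs with h
  · simp
  · rw [Finset.erase_eq_of_notMem h, one_mul]

theorem weightPoly_weightIn (i : κ) (m : Finset κ → ℝ) (w : κ → ℂ) :
    weightPoly (weightIn i m) w = w i * slopeIn i (weightPoly m) w := by
  simp only [slopeIn, weightPoly, prod_update_eq, weightIn, ← Finset.sum_sub_distrib,
    Finset.mul_sum]
  refine Finset.sum_congr rfl fun S _ => ?_
  split_ifs with h
  · rw [← Finset.mul_prod_erase S _ h]
    ring
  · simp

/-- A nonzero nonnegative homogeneous weight whose generating function is stable. -/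
structure StableWeight (d : ℕ) (m : Finset κ → ℝ) : Prop where
  nonneg : ∀ S, 0 ≤ m S
  card : ∀ S, m S ≠ 0 → S.card = d
  sum_pos : 0 < ∑ S, m S
  stable : NonvanishingOnUpper (weightPoly m)

theorem weightPoly_combination (i : κ) (m : Finset κ → ℝ) (s t : ℝ) (w : κ → ℂ) :
    weightPoly (s • weightIn i m + t • weightOut i m) w =
      s * weightPoly (weightIn i m) w + t * weightPoly (weightOut i m) w := by
  simp only [weightPoly, Finset.mul_sum, ← Finset.sum_add_distrib]
  refine Finset.sum_congr rfl fun S _ => ?_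
  simp
  ring

/-- Rescaling `w_i` by `s / t > 0` preserves the upper half plane, and `t` times the rescaled
generating function is the combination. -/
theorem StableWeight.combination {d : ℕ} {m : Finset κ → ℝ} (hm : StableWeight d m) (i : κ)
    {s t : ℝ} (hs : 0 < s) (ht : 0 < t) :
    StableWeight d (s • weightIn i m + t • weightOut i m) where
  nonneg S := by
    have := hm.nonneg S
    by_cases h : i ∈ S <;> simp [weightIn, weightOut, h] <;> positivity
  card S h := by
    refine hm.card S fun h0 => h ?_
    simp [weightIn, weightOut, h0]
  sum_pos := by
    obtain ⟨S, -, hS⟩ := Finset.exists_ne_zero_of_sum_ne_zero hm.sum_pos.ne'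
    have hS' := (hm.nonneg S).lt_of_ne' hS
    refine Finset.sum_pos' (fun S _ => ?_) ⟨S, Finset.mem_univ S, ?_⟩
    · have := hm.nonneg S
      by_cases h : i ∈ S <;> simp [weightIn, weightOut, h] <;> positivity
    · by_cases h : i ∈ S <;> simp [weightIn, weightOut, h] <;> positivity
  stable w hw := by
    have hne : (t : ℂ) ≠ 0 := by exact_mod_cast ht.ne'
    have h := hm.stable (Function.update w i ((s / t : ℝ) * w i)) (fun j => by
      rcases eq_or_ne j i with rfl | hj
      · rw [Function.update_self, Complex.im_ofReal_mul]
        exact mul_pos (div_pos hs ht) (hw _)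
      · simpa [hj] using hw j)
    rw [weightPoly_combination, weightPoly_weightIn, weightPoly_weightOut]
    rw [(realMultiAffine_weightPoly m).affine] at h
    have : (s : ℂ) = (s / t : ℝ) * t := by
      rw [Complex.ofReal_div, div_mul_cancel₀ _ hne]
    rw [this]
    convert mul_ne_zero hne h using 1
    ring

/-- `P = P|_{w_i = 0} + w_i ∂_i P` is a pencil with parameter `w_i`. A zero of `∂_i P` would make it
vanish at `(I, …, I)` too, where homogeneity gives a positive mass times a power of `I`. -/
theorem StableWeight.weightIn_of_pos {d : ℕ} {m : Finset κ → ℝ} (hm : StableWeight d m) (i : κ)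
    (h : 0 < ∑ S, weightIn i m S) : StableWeight d (weightIn i m) where
  nonneg S := by
    have := hm.nonneg S
    unfold weightIn
    split_ifs <;> simp [this]
  card S hS := hm.card S fun h0 => hS (by simp [weightIn, h0])
  sum_pos := h
  stable w hw hzero := by
    have hcard (S) (hS : weightIn i m S ≠ 0) : S.card = d :=
      hm.card S fun h0 => hS (by simp [weightIn, h0])
    have hP := (realMultiAffine_weightPoly m).affine
    have hO : MultiAffine (fun w => weightPoly m (Function.update w i 0)) := by
      have := (realMultiAffine_weightPoly (weightOut i m)).affine
      rwa [show weightPoly (weightOut i m) = _ from funext (weightPoly_weightOut i m)] at this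
    rw [weightPoly_weightIn] at hzero
    have hwi : w i ≠ 0 := fun h0 => by simpa [h0] using hw i
    have hI := eq_zero_of_nonvanishing_pencil (hP.slopeIn i) hO (fun x hx u hu => by
      rw [← hP i x u]
      exact hm.stable _ fun j => by
        rcases eq_or_ne j i with rfl | hj
        · simpa using hu
        · simpa [hj] using hx j) hw (y := fun _ => Complex.I) (by simp)
      ((mul_eq_zero.1 hzero).resolve_left hwi)
    have h1 := weightPoly_weightIn i m fun _ => Complex.I
    rw [hI, mul_zero, weightPoly_const hcard] at h1
    refine mul_ne_zero ?_ (pow_ne_zero d Complex.I_ne_zero) h1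
    exact_mod_cast h.ne'

/-- The substitution `w_i = -1 / u` preserves the upper half plane and turns `P` into the pencil `u
P|_{w_i = 0} - ∂_i P`, up to the factor `u`. -/
theorem StableWeight.weightOut_of_pos {d : ℕ} {m : Finset κ → ℝ} (hm : StableWeight d m) (i : κ)
    (h : 0 < ∑ S, weightOut i m S) : StableWeight d (weightOut i m) where
  nonneg S := by
    have := hm.nonneg S
    unfold weightOut
    split_ifs <;> simp [this]
  card S hS := hm.card S fun h0 => hS (by simp [weightOut, h0])
  sum_pos := h
  stable w hw hzero := by
    have hcard (S) (hS : weightOut i m S ≠ 0) : S.card = d :=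
      hm.card S fun h0 => hS (by simp [weightOut, h0])
    have hP := (realMultiAffine_weightPoly m).affine
    have hO := (realMultiAffine_weightPoly (weightOut i m)).affine
    have hN : MultiAffine ((-1 : ℂ) • slopeIn i (weightPoly m)) := by
      intro j x t
      rw [slopeIn_smul, Pi.smul_apply, Pi.smul_apply, Pi.smul_apply, (hP.slopeIn i) j x t,
        smul_add, mul_smul_comm]
    have hI := eq_zero_of_nonvanishing_pencil hO hN (fun x hx u hu => by
      have hu0 : u ≠ 0 := fun h0 => by simp [h0] at hu
      have h2 := hm.stable (Function.update x i (-u⁻¹)) fun j => by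
        rcases eq_or_ne j i with rfl | hj
        · rw [Function.update_self, Complex.neg_im, Complex.inv_im, neg_div, neg_neg]
          exact div_pos hu (Complex.normSq_pos.2 hu0)
        · simpa [hj] using hx j
      rw [hP] at h2
      rw [weightPoly_weightOut]
      convert mul_ne_zero hu0 h2 using 1
      rw [mul_add, ← mul_assoc, mul_neg, mul_inv_cancel₀ hu0]
      simp [add_comm]) hw (y := fun _ => Complex.I) (by simp) hzero
    rw [weightPoly_const hcard] at hI
    refine mul_ne_zero ?_ (pow_ne_zero d Complex.I_ne_zero) hI
    exact_mod_cast h.ne'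

end Conditioning

/-! ### Choosing a single set by interlacing -/

section Selection

open Polynomial

variable {κ : Type*}

/-- A mixture of real polynomials indexed by the subsets of a finite type. -/
noncomputable def mixture [Fintype κ] (χ : Finset κ → ℝ[X]) (m : Finset κ → ℝ) : ℝ[X] :=
  ∑ S, C (m S) * χ S

/-- Homogeneity enters here: all polynomials of nonzero weight have degree `d`, so the top
coefficient of the mixture is the total mass. -/
theorem StableWeight.mixture_coeff [Fintype κ] {d : ℕ} {m : Finset κ → ℝ} (hm : StableWeight d m)
    {χ : Finset κ → ℝ[X]} (hχ : ∀ S, (χ S).Monic) (hdeg : ∀ S, (χ S).natDegree = S.card) :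
    (mixture χ m).natDegree ≤ d ∧ 0 < (mixture χ m).coeff d := by
  constructor
  · refine natDegree_sum_le_of_forall_le _ _ fun S _ => ?_
    rcases eq_or_ne (m S) 0 with h | h
    · simp [h]
    · exact (natDegree_C_mul_le _ _).trans (by rw [hdeg, hm.card S h])
  · have : (mixture χ m).coeff d = ∑ S, m S := by
      rw [mixture, finsetSum_coeff]
      refine Finset.sum_congr rfl fun S _ => ?_
      rw [coeff_C_mul]
      rcases eq_or_ne (m S) 0 with h | h
      · simp [h]
      · rw [← hm.card S h, ← hdeg S, (hχ S).coeff_natDegree, mul_one]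
    rw [this]
    exact hm.sum_pos

variable [DecidableEq κ]

theorem weightIn_add_weightOut (i : κ) (m : Finset κ → ℝ) :
    (1 : ℝ) • weightIn i m + (1 : ℝ) • weightOut i m = m := by
  funext S
  by_cases h : i ∈ S <;> simp [weightIn, weightOut, h]

/-- The characteristic polynomial of a principal submatrix of a hermitian matrix, as a real
polynomial. -/
noncomputable def realCharpoly {A : Matrix κ κ ℂ} (hA : A.IsHermitian) (S : Finset κ) : ℝ[X] :=
  ∏ i, (X - C ((hA.submatrix (Subtype.val : S → κ)).eigenvalues i))

theorem monic_realCharpoly {A : Matrix κ κ ℂ} (hA : A.IsHermitian) (S : Finset κ) :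
    (realCharpoly hA S).Monic :=
  monic_prod_of_monic _ _ fun _ _ => monic_X_sub_C _

theorem natDegree_realCharpoly {A : Matrix κ κ ℂ} (hA : A.IsHermitian) (S : Finset κ) :
    (realCharpoly hA S).natDegree = S.card := by
  rw [realCharpoly, natDegree_prod_of_monic _ _ fun _ _ => monic_X_sub_C _]
  simp

theorem aeval_realCharpoly {A : Matrix κ κ ℂ} (hA : A.IsHermitian) (S : Finset κ) (z : ℂ) :
    aeval z (realCharpoly hA S) =
      ((A.submatrix Subtype.val Subtype.val : Matrix S S ℂ).charpoly).eval z := by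
  rw [(hA.submatrix (Subtype.val : S → κ)).charpoly_eq, realCharpoly, map_prod, eval_prod]
  simp

theorem eigenvalues_lt_of_realCharpoly_pos {A : Matrix κ κ ℂ} (hA : A.IsHermitian)
    {S : Finset κ} {c : ℝ} (h : ∀ x, c ≤ x → 0 < (realCharpoly hA S).eval x) (i : S) :
    (hA.submatrix (Subtype.val : S → κ)).eigenvalues i < c := by
  by_contra! hc
  refine (h _ hc).ne' ?_
  rw [realCharpoly, eval_prod]
  exact Finset.prod_eq_zero (Finset.mem_univ i) (by simp)

variable [Fintype κ]

theorem mixture_combination (χ : Finset κ → ℝ[X]) (i : κ) (m : Finset κ → ℝ) (s t : ℝ) :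
    mixture χ (s • weightIn i m + t • weightOut i m) =
      C s * mixture χ (weightIn i m) + C t * mixture χ (weightOut i m) := by
  simp only [mixture, Finset.mul_sum, ← Finset.sum_add_distrib]
  refine Finset.sum_congr rfl fun S _ => ?_
  simp
  ring

theorem StableWeight.condition {d : ℕ} {χ : Finset κ → ℝ[X]} (hχ : ∀ S, (χ S).Monic)
    (hdeg : ∀ S, (χ S).natDegree = S.card)
    (hroots : ∀ m, StableWeight d m → ∀ z : ℂ, aeval z (mixture χ m) = 0 → z.im = 0)
    {m : Finset κ → ℝ} (hm : StableWeight d m) {c : ℝ}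
    (hpos : ∀ x, c ≤ x → 0 < (mixture χ m).eval x) (i : κ) :
    (StableWeight d (weightIn i m) ∧ ∀ x, c ≤ x → 0 < (mixture χ (weightIn i m)).eval x) ∨
    (StableWeight d (weightOut i m) ∧ ∀ x, c ≤ x → 0 < (mixture χ (weightOut i m)).eval x) := by
  have hin (S : Finset κ) : 0 ≤ weightIn i m S := by
    have := hm.nonneg S
    unfold weightIn
    split_ifs <;> simp [this]
  have hout (S : Finset κ) : 0 ≤ weightOut i m S := by
    have := hm.nonneg S
    unfold weightOut
    split_ifs <;> simp [this]
  have hadd := weightIn_add_weightOut i m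
  simp only [one_smul] at hadd
  rcases (Finset.sum_nonneg fun S (_ : S ∈ Finset.univ) => hin S).eq_or_lt with h1 | h1
  · have h0 : weightIn i m = 0 := funext fun S =>
      (Finset.sum_eq_zero_iff_of_nonneg fun S _ => hin S).1 h1.symm S (Finset.mem_univ S)
    rw [h0, zero_add] at hadd
    rw [hadd]
    exact Or.inr ⟨hm, hpos⟩
  rcases (Finset.sum_nonneg fun S (_ : S ∈ Finset.univ) => hout S).eq_or_lt with h2 | h2
  · have h0 : weightOut i m = 0 := funext fun S =>
      (Finset.sum_eq_zero_iff_of_nonneg fun S _ => hout S).1 h2.symm S (Finset.mem_univ S)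
    rw [h0, add_zero] at hadd
    rw [hadd]
    exact Or.inl ⟨hm, hpos⟩
  have hi := hm.weightIn_of_pos i h1
  have ho := hm.weightOut_of_pos i h2
  obtain ⟨hi1, hi2⟩ := hi.mixture_coeff hχ hdeg
  obtain ⟨ho1, ho2⟩ := ho.mixture_coeff hχ hdeg
  refine (eval_pos_or_of_interlacing hi1 ho1 hi2 ho2 (fun s t hs ht z hz => ?_) ?_).imp
    (⟨hi, ·⟩) (⟨ho, ·⟩)
  · exact hroots _ (hm.combination i hs ht) z (by rwa [mixture_combination])
  · have := mixture_combination χ i m 1 1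
    rw [weightIn_add_weightOut] at this
    simpa [this] using hpos

/-- The method of interlacing polynomials for stable weights. -/
theorem StableWeight.exists_eval_pos {d : ℕ} {χ : Finset κ → ℝ[X]} (hχ : ∀ S, (χ S).Monic)
    (hdeg : ∀ S, (χ S).natDegree = S.card)
    (hroots : ∀ m, StableWeight d m → ∀ z : ℂ, aeval z (mixture χ m) = 0 → z.im = 0)
    {m : Finset κ → ℝ} (hm : StableWeight d m) {c : ℝ}
    (hpos : ∀ x, c ≤ x → 0 < (mixture χ m).eval x) :
    ∃ S, 0 < m S ∧ ∀ x, c ≤ x → 0 < (χ S).eval x := by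
  -- `B` records the decisions made on `T`; for `T = univ` only the set `B` itself keeps its weight.
  suffices H : ∀ T : Finset κ, ∃ B, StableWeight d (fun S => if S ∩ T = B then m S else 0) ∧
      ∀ x, c ≤ x → 0 < (mixture χ fun S => if S ∩ T = B then m S else 0).eval x by
    obtain ⟨B, hB, hBpos⟩ := H Finset.univ
    simp only [Finset.inter_univ] at hB hBpos
    have hsum := hB.sum_pos
    simp only [Finset.sum_ite_eq', Finset.mem_univ, if_true] at hsum
    refine ⟨B, hsum, fun x hx => ?_⟩
    have := hBpos x hx
    simp only [mixture, apply_ite C, map_zero, ite_mul, zero_mul, Finset.sum_ite_eq',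
      Finset.mem_univ, if_true, eval_mul, eval_C] at this
    exact pos_of_mul_pos_right this hsum.le
  intro T
  induction T using Finset.induction_on with
  | empty => exact ⟨∅, by simpa using ⟨hm, hpos⟩⟩
  | insert i T hi ih =>
    obtain ⟨B, hB, hBpos⟩ := ih
    have hiB : i ∉ B := fun h => by
      obtain ⟨S, -, hS⟩ := Finset.exists_ne_zero_of_sum_ne_zero hB.sum_pos.ne'
      have hST : S ∩ T = B := by
        by_contra h'
        simp [h'] at hS
      exact hi (Finset.mem_inter.1 (hST ▸ h)).2
    rcases hB.condition hχ hdeg hroots hBpos i with h | h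
    · refine ⟨insert i B, ?_⟩
      have e : (fun S => if S ∩ insert i T = insert i B then m S else 0) =
          weightIn i fun S => if S ∩ T = B then m S else 0 := by
        funext S
        have : S ∩ insert i T = insert i B ↔ i ∈ S ∧ S ∩ T = B := by
          simp only [Finset.ext_iff, Finset.mem_inter, Finset.mem_insert]
          grind
        simp only [weightIn, this, ite_and]
      rwa [e]
    · refine ⟨B, ?_⟩
      have e : (fun S => if S ∩ insert i T = B then m S else 0) =
          weightOut i fun S => if S ∩ T = B then m S else 0 := by
        funext S
        have : S ∩ insert i T = B ↔ i ∉ S ∧ S ∩ T = B := by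
          simp only [Finset.ext_iff, Finset.mem_inter, Finset.mem_insert]
          grind
        simp only [weightOut, this, ite_and, ite_not]
      rwa [e]

theorem aeval_mixture_realCharpoly {A : Matrix κ κ ℂ} (hA : A.IsHermitian) (m : Finset κ → ℝ)
    (z : ℂ) : aeval z (mixture (realCharpoly hA) m) = mixedCharpoly A m z := by
  simp [mixture, mixedCharpoly, aeval_realCharpoly]

theorem StableWeight.exists_realCharpoly_pos {A : Matrix κ κ ℂ} (hA : A.IsHermitian) {d : ℕ}
    {m : Finset κ → ℝ} (hm : StableWeight d m) {c : ℝ}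
    (hpos : ∀ x : ℝ, c ≤ x → 0 < (mixedCharpoly A m x).re) :
    ∃ S, 0 < m S ∧ ∀ x, c ≤ x → 0 < (realCharpoly hA S).eval x := by
  refine hm.exists_eval_pos (monic_realCharpoly hA) (natDegree_realCharpoly hA)
    (fun m hm z hz => ?_) fun x hx => ?_
  · by_contra him
    rcases lt_or_gt_of_ne him with h | h
    · have h2 : aeval (star z) (mixture (realCharpoly hA) m) = 0 := by
        have := aeval_conj (mixture (realCharpoly hA) m) z
        rw [hz, map_zero] at this
        exact this
      rw [aeval_mixture_realCharpoly] at h2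
      exact mixedCharpoly_ne_zero hA hm.stable (by simpa using h) h2
    · rw [aeval_mixture_realCharpoly] at hz
      exact mixedCharpoly_ne_zero hA hm.stable h hz
  · have := hpos x hx
    rw [← aeval_mixture_realCharpoly hA] at this
    have h2 : aeval ((algebraMap ℝ ℂ) x) (mixture (realCharpoly hA) m) =
        (((mixture (realCharpoly hA) m).eval x : ℝ) : ℂ) := by
      rw [aeval_algebraMap_apply]; simp
    rw [Complex.coe_algebraMap] at h2
    rwa [h2, Complex.ofReal_re] at this

end Selection

/-! ### Diagonal of the resolvent of a positive contraction -/

section ResolventBound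

variable {n : ℕ}

theorem posSemidef_one_sub_of_contraction {A : Matrix (Fin n) (Fin n) ℂ} (hA : A.IsHermitian)
    (hc : IsMatrixContraction A) : (1 - A).PosSemidef := by
  refine Matrix.PosSemidef.of_dotProduct_mulVec_nonneg (Matrix.isHermitian_one.sub hA) fun v => ?_
  have him := (Matrix.isHermitian_one.sub hA).im_star_dotProduct_mulVec_self v
  rw [Complex.nonneg_iff]
  refine ⟨?_, him.symm⟩
  rw [Matrix.sub_mulVec, Matrix.one_mulVec, dotProduct_sub, Complex.sub_re, sub_nonneg]
  set x : EuclideanSpace ℂ (Fin n) := WithLp.toLp 2 v with hx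
  set T := Matrix.toEuclideanCLM (n := Fin n) (𝕜 := ℂ) A with hT
  have h1 : inner ℂ x (T x) = star v ⬝ᵥ A.mulVec v := by
    rw [hT, hx, Matrix.toEuclideanCLM_toLp, EuclideanSpace.inner_toLp_toLp, dotProduct_comm]
  have h2 : inner ℂ x x = star v ⬝ᵥ v := by
    rw [hx, EuclideanSpace.inner_toLp_toLp, dotProduct_comm]
  rw [← h1, ← h2]
  calc (inner ℂ x (T x)).re ≤ ‖x‖ * ‖T x‖ := re_inner_le_norm (𝕜 := ℂ) x (T x)
    _ ≤ ‖x‖ * (1 * ‖x‖) := by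
      gcongr
      exact T.le_of_opNorm_le hc x
    _ = (inner ℂ x x).re := by
      rw [one_mul]
      exact (inner_self_eq_norm_mul_norm (𝕜 := ℂ) x).symm

theorem posDef_diagonal_sub {A : Matrix (Fin n) (Fin n) ℂ} (h : (1 - A).PosSemidef)
    {z : Fin n → ℝ} (hz : ∀ i, 1 < z i) :
    (Matrix.diagonal (fun i => (z i : ℂ)) - A).PosDef := by
  have h1 : (Matrix.diagonal fun i => ((z i - 1 : ℝ) : ℂ)).PosDef :=
    Matrix.PosDef.diagonal fun i => by
      rw [Complex.zero_lt_real]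
      linarith [hz i]
  have h2 : Matrix.diagonal (fun i => (z i : ℂ)) - A =
      (Matrix.diagonal fun i => ((z i - 1 : ℝ) : ℂ)) + (1 - A) := by
    have : (Matrix.diagonal fun i => ((z i - 1 : ℝ) : ℂ)) =
        Matrix.diagonal (fun i => (z i : ℂ)) - 1 := by
      rw [← Matrix.diagonal_one, Matrix.diagonal_sub]
      congr 1
      funext i
      simp
    rw [this]
    abel
  rw [h2]
  exact h1.add_posSemidef h

/-- In a scalar `t` this is `(x - t) t (1 - t) / (x (x - 1))`, the chord bound minus `1 / (x - t)`,
times `(x - t)²`. Splitting `t (1 - t) = (1 - t) t (1 - t) + t (1 - t) t` exhibits it as a sum of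
congruences of `A` and `1 - A`. -/
theorem posSemidef_resolvent_factor {A : Matrix (Fin n) (Fin n) ℂ} (hA : A.PosSemidef)
    (h : (1 - A).PosSemidef) {x : ℝ} (hx : 1 ≤ x) :
    (((x : ℂ) * (x - 1))⁻¹ • (((x : ℂ) - 1) • ((1 - A) * A * (1 - A) + A * (1 - A) * A) +
      (1 - A) * A * (1 - A))).PosSemidef := by
  have p1 := hA.conjTranspose_mul_mul_same (1 - A)
  have p2 := h.conjTranspose_mul_mul_same A
  rw [h.isHermitian.eq] at p1
  rw [hA.isHermitian.eq] at p2
  have c1 : (0 : ℂ) ≤ (x : ℂ) - 1 := by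
    have : (0 : ℝ) ≤ x - 1 := by linarith
    exact_mod_cast this
  have c2 : (0 : ℂ) ≤ ((x : ℂ) * (x - 1))⁻¹ := by
    have : (0 : ℝ) ≤ (x * (x - 1))⁻¹ := inv_nonneg.2 (mul_nonneg (by linarith) (by linarith))
    exact_mod_cast this
  exact (((p1.add p2).smul c1).add p1).smul c2

/-- The resolvent of a positive contraction is bounded by the chord of `t ↦ 1 / (x - t)`. -/
theorem posSemidef_chord_sub_resolvent {A : Matrix (Fin n) (Fin n) ℂ} (hA : A.PosSemidef)
    (h : (1 - A).PosSemidef) {x : ℝ} (hx : 1 < x) :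
    ((x : ℂ)⁻¹ • (1 : Matrix (Fin n) (Fin n) ℂ) + ((x : ℂ) * (x - 1))⁻¹ • A -
      ((x : ℂ) • (1 : Matrix (Fin n) (Fin n) ℂ) - A)⁻¹).PosSemidef := by
  set M := (x : ℂ) • (1 : Matrix (Fin n) (Fin n) ℂ) - A with hM
  set B := (x : ℂ)⁻¹ • (1 : Matrix (Fin n) (Fin n) ℂ) + ((x : ℂ) * (x - 1))⁻¹ • A with hB
  have hx0 : (x : ℂ) ≠ 0 := by exact_mod_cast (by linarith : x ≠ 0)
  have hx1 : (x : ℂ) - 1 ≠ 0 := by exact_mod_cast (by linarith : x - 1 ≠ 0)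
  have hMpos : M.PosDef := by
    have := posDef_diagonal_sub h (z := fun _ => x) fun _ => hx
    rwa [← Matrix.smul_one_eq_diagonal] at this
  have hunit : IsUnit M.det := (Matrix.isUnit_iff_isUnit_det M).1 hMpos.isUnit
  have hN := posSemidef_resolvent_factor hA h hx.le
  have hfac : M * B * M - M = ((x : ℂ) * (x - 1))⁻¹ • (((x : ℂ) - 1) •
      ((1 - A) * A * (1 - A) + A * (1 - A) * A) + (1 - A) * A * (1 - A)) := by
    simp only [hM, hB, mul_add, add_mul, mul_sub, sub_mul, smul_mul_assoc, mul_smul_comm, mul_one,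
      one_mul, mul_assoc]
    match_scalars <;> field_simp <;> ring
  have hB' : B - M⁻¹ = (M⁻¹).conjTranspose * (M * B * M - M) * M⁻¹ := by
    rw [hMpos.isHermitian.inv.eq, mul_sub, sub_mul, Matrix.nonsing_inv_mul _ hunit, one_mul,
      mul_assoc M B M, ← mul_assoc, Matrix.nonsing_inv_mul _ hunit, one_mul, mul_assoc,
      Matrix.mul_nonsing_inv _ hunit, mul_one]
  rw [hB', hfac]
  exact hN.conjTranspose_mul_mul_same _

theorem realValue_borderedDet_pos {A : Matrix (Fin n) (Fin n) ℂ} (h : (1 - A).PosSemidef)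
    {z : Fin n → ℝ} (hz : ∀ i, 1 < z i) : 0 < realValue (borderedDet A ∅) z := by
  have := (posDef_diagonal_sub h hz).det_pos
  rw [← borderedMatrix_empty] at this
  exact (Complex.pos_iff.1 this).1

/-- By Cramer's rule the logarithmic derivative of `det(diag(z) - A)` in `z_i` is the `i`-th
diagonal entry of the resolvent. -/
theorem realValue_borderedDet_singleton_le {A : Matrix (Fin n) (Fin n) ℂ} (hA : A.PosSemidef)
    (h : (1 - A).PosSemidef) {x α : ℝ} (hx : 1 < x) {i : Fin n} (hα : (A i i).re ≤ α) :
    realValue (borderedDet A {i}) (fun _ => x) ≤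
      (x⁻¹ + (x * (x - 1))⁻¹ * α) * realValue (borderedDet A ∅) fun _ => x := by
  have hpos := realValue_borderedDet_pos h (z := fun _ => x) fun _ => hx
  set M := (x : ℂ) • (1 : Matrix (Fin n) (Fin n) ℂ) - A with hM
  have hM0 : borderedMatrix A ∅ (fun _ => (x : ℂ)) = M := by
    rw [borderedMatrix_empty, ← Matrix.smul_one_eq_diagonal]
  have hdet : M.det = (realValue (borderedDet A ∅) (fun _ => x) : ℂ) := by
    rw [(realMultiAffine_borderedDet hA.isHermitian).coe_realValue, borderedDet, hM0]
  have hunit : IsUnit M.det := by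
    rw [hdet, isUnit_iff_ne_zero]
    exact_mod_cast hpos.ne'
  have hadj : borderedDet A {i} (fun _ => (x : ℂ)) = M.det * M⁻¹ i i := by
    rw [borderedDet, ← insert_empty_eq, borderedMatrix_insert, hM0, ← Matrix.adjugate_apply,
      Matrix.inv_def, Matrix.smul_apply, smul_eq_mul, ← mul_assoc, Ring.mul_inverse_cancel _ hunit,
      one_mul]
  have hdiag := (posSemidef_chord_sub_resolvent hA h hx).diag_nonneg (i := i)
  have hre := (Complex.nonneg_iff.1 hdiag).1
  have e : ((x : ℂ)⁻¹ • (1 : Matrix (Fin n) (Fin n) ℂ) + ((x : ℂ) * (x - 1))⁻¹ • A - M⁻¹) i i =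
      (x⁻¹ : ℝ) + ((x * (x - 1))⁻¹ : ℝ) * A i i - M⁻¹ i i := by
    simp
  rw [e, Complex.sub_re, Complex.add_re, Complex.ofReal_re, Complex.re_ofReal_mul] at hre
  have hval : realValue (borderedDet A {i}) (fun _ => x) =
      realValue (borderedDet A ∅) (fun _ => x) * (M⁻¹ i i).re := by
    rw [realValue, hadj, hdet, Complex.re_ofReal_mul]
  rw [hval, mul_comm]
  refine mul_le_mul_of_nonneg_right ?_ hpos.le
  have hinv : 0 ≤ (x * (x - 1))⁻¹ := inv_nonneg.2 (mul_nonneg (by linarith) (by linarith))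
  have := mul_le_mul_of_nonneg_left hα hinv
  linarith

end ResolventBound

/-! ### Weights from measures, and the numerical choice of parameters -/

section Measure

variable {n : ℕ}

/-- The weight function of a probability measure. -/
def pmfWeight (μ : PMF (Finset (Fin n))) (S : Finset (Fin n)) : ℝ := (μ S).toReal

theorem weightPoly_pmfWeight (μ : PMF (Finset (Fin n))) (w : Fin n → ℂ) :
    weightPoly (pmfWeight μ) w = MvPolynomial.aeval w (generatingPoly μ) := by
  simp [weightPoly, generatingPoly, pmfWeight]

open Classical in
theorem prob_eq_sum (μ : PMF (Finset (Fin n))) (E : Set (Finset (Fin n))) :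
    prob μ E = ∑ S, if S ∈ E then pmfWeight μ S else 0 := by
  rw [prob, PMF.toOuterMeasure_apply_fintype, ENNReal.toReal_sum]
  · refine Finset.sum_congr rfl fun S _ => ?_
    by_cases h : S ∈ E <;> simp [h, pmfWeight]
  · intro S _
    by_cases h : S ∈ E <;> simp [h, μ.apply_ne_top]

theorem sum_pmfWeight (μ : PMF (Finset (Fin n))) : ∑ S, pmfWeight μ S = 1 := by
  have h := μ.tsum_coe
  rw [tsum_fintype] at h
  simp only [pmfWeight]
  rw [← ENNReal.toReal_sum fun S _ => μ.apply_ne_top S, h, ENNReal.toReal_one]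

theorem marginal_eq_sum (μ : PMF (Finset (Fin n))) (i : Fin n) :
    marginal μ i = ∑ S, weightIn i (pmfWeight μ) S := by
  rw [marginal, prob_eq_sum]
  refine Finset.sum_congr rfl fun S _ => ?_
  by_cases h : i ∈ S <;> simp [weightIn, h]

theorem coeff_generatingPoly (μ : PMF (Finset (Fin n))) (S : Finset (Fin n)) :
    (generatingPoly μ).coeff (∑ i ∈ S, Finsupp.single i 1) = pmfWeight μ S := by
  have happ (T : Finset (Fin n)) (j : Fin n) :
      (∑ i ∈ T, Finsupp.single i 1 : Fin n →₀ ℕ) j = if j ∈ T then 1 else 0 := by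
    simp [Finsupp.finsetSum_apply, Finsupp.single_apply]
  have hinj (T : Finset (Fin n)) :
      (∑ i ∈ T, Finsupp.single i 1 : Fin n →₀ ℕ) = ∑ i ∈ S, Finsupp.single i 1 ↔ T = S := by
    refine ⟨fun h => Finset.ext fun j => ?_, fun h => h ▸ rfl⟩
    have := DFunLike.congr_fun h j
    rw [happ, happ] at this
    by_cases h1 : j ∈ T <;> by_cases h2 : j ∈ S <;> simp_all
  have hprod (T : Finset (Fin n)) : (∏ i ∈ T, MvPolynomial.X i : MvPolynomial (Fin n) ℝ) =
      MvPolynomial.monomial (∑ i ∈ T, Finsupp.single i 1) 1 := by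
    rw [MvPolynomial.monomial_sum_one]
    rfl
  simp [generatingPoly, MvPolynomial.coeff_sum, hprod, MvPolynomial.coeff_C_mul,
    MvPolynomial.coeff_monomial, hinj, pmfWeight]

theorem stableWeight_pmfWeight {μ : PMF (Finset (Fin n))} {d : ℕ}
    (hd : (generatingPoly μ).IsHomogeneous d) (hSR : IsStronglyRayleigh μ) :
    StableWeight d (pmfWeight μ) where
  nonneg S := ENNReal.toReal_nonneg
  card S hS := by
    by_contra hne
    refine hS ?_
    rw [← coeff_generatingPoly]
    refine hd.coeff_eq_zero ?_
    simpa [map_sum] using hne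
  sum_pos := by rw [sum_pmfWeight]; exact one_pos
  stable w hw := by
    rw [weightPoly_pmfWeight]
    exact hSR w hw

theorem realValue_weightPoly_pos {d : ℕ} {m : Finset (Fin n) → ℝ} (hm : StableWeight d m)
    {w : Fin n → ℝ} (hw : ∀ i, 0 < w i) : 0 < realValue (weightPoly m) w := by
  have h : realValue (weightPoly m) w = ∑ S, m S * ∏ i ∈ S, w i := by
    have : weightPoly m (fun i => (w i : ℂ)) = ((∑ S, m S * ∏ i ∈ S, w i : ℝ) : ℂ) := by
      simp [weightPoly]
    rw [realValue, this, Complex.ofReal_re]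
  rw [h]
  obtain ⟨S, -, hS⟩ := Finset.exists_ne_zero_of_sum_ne_zero hm.sum_pos.ne'
  have hprod (S : Finset (Fin n)) : 0 < ∏ i ∈ S, w i := Finset.prod_pos fun i _ => hw i
  exact Finset.sum_pos' (fun S _ => mul_nonneg (hm.nonneg S) (hprod S).le)
    ⟨S, Finset.mem_univ S, mul_pos ((hm.nonneg S).lt_of_ne' hS) (hprod S)⟩

/-- At a constant point homogeneity gives `y * ∂_i P = y ^ d * ∑ weightIn i m`, so the logarithmic
derivative is the normalised marginal divided by `y`. -/
theorem realValue_slopeIn_weightPoly_le {d : ℕ} {m : Finset (Fin n) → ℝ}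
    (hm : StableWeight d m) {i : Fin n} {ε y : ℝ} (hy : 0 < y)
    (hε : ∑ S, weightIn i m S ≤ ε * ∑ S, m S) :
    realValue (slopeIn i (weightPoly m)) (fun _ => y) ≤
      ε / y * realValue (weightPoly m) fun _ => y := by
  have hin (S) (hS : weightIn i m S ≠ 0) : S.card = d :=
    hm.card S fun h0 => hS (by simp [weightIn, h0])
  have h1 := weightPoly_weightIn i m fun _ => (y : ℂ)
  rw [weightPoly_const hin, ← ((realMultiAffine_weightPoly m).slopeIn i).coe_realValue
    (fun _ => y)] at h1
  have h2 := weightPoly_const hm.card (y : ℂ)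
  rw [← (realMultiAffine_weightPoly m).coe_realValue (fun _ => y)] at h2
  have h1' : (∑ S, weightIn i m S) * y ^ d =
      y * realValue (slopeIn i (weightPoly m)) fun _ => y := by exact_mod_cast h1
  have h2' : realValue (weightPoly m) (fun _ => y) = (∑ S, m S) * y ^ d := by exact_mod_cast h2
  rw [h2', div_mul_eq_mul_div, le_div_iff₀ hy, mul_comm, ← h1', ← mul_assoc]
  exact mul_le_mul_of_nonneg_right hε (pow_nonneg hy.le d)

theorem lambdaMax_lt {ι : Type*} [Fintype ι] [DecidableEq ι] {M : Matrix ι ι ℂ}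
    (hM : M.IsHermitian) {b c : ℝ} (h : ∀ i, hM.eigenvalues i ≤ b) (hbc : b < c) :
    lambdaMax M < c := by
  refine lt_of_le_of_lt (b := (b : EReal)) (iSup₂_le fun r hr => ?_) (EReal.coe_lt_coe hbc)
  rw [hM.spectrum_real_eq_range_eigenvalues] at hr
  obtain ⟨i, rfl⟩ := hr
  exact EReal.coe_le_coe (h i)

/-- With `e = ε^(1/4)`, the choice `x - 1 + α = 1 / e` gives `1 / a = e * x * (x - 1)`. For fixed
`a` and `e < 1`, `ε / b - 1 / (a + b)` is least at `b = e² a / (1 - e²)`; the simpler `b = e² a` is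
close to it for small `e`. -/
theorem barrier_value_lt {e α : ℝ} (he : 0 < e) (he1 : e ≤ 1) (hα : 0 ≤ α) (hα1 : α < 1)
    {a : ℝ} (ha : a = (e⁻¹ + 1 - α)⁻¹ + ((e⁻¹ + 1 - α) * (e⁻¹ + 1 - α - 1))⁻¹ * α) :
    0 < a ∧ e⁻¹ + 1 - α + e ^ 4 / (e ^ 2 * a) - 1 / (a + e ^ 2 * a) < 4 * e + α := by
  have h1 : 0 < 1 - α * e := by nlinarith
  have h2 : 0 < 1 + e - α * e := by linarith
  have hK : e⁻¹ + 1 - α = (1 + e - α * e) / e := by field_simp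
  have hK1 : e⁻¹ + 1 - α - 1 = (1 - α * e) / e := by field_simp; ring
  have ha' : a = e / ((1 + e - α * e) * (1 - α * e)) := by
    rw [ha, hK1, hK]
    have hpq : (1 - α * e) + α * e = 1 := by ring
    generalize 1 + e - α * e = p at h2 ⊢
    generalize 1 - α * e = q at h1 hpq ⊢
    field_simp
    linear_combination hpq
  have ha0 : 0 < a := by rw [ha']; positivity
  refine ⟨ha0, ?_⟩
  have hD : 4 * e + α - (e⁻¹ + 1 - α + e ^ 4 / (e ^ 2 * a) - 1 / (a + e ^ 2 * a)) =
      e * (2 + 3 * e ^ 2 - 2 * e - e ^ 3 + α * (4 * e + 2 * e ^ 3 + e ^ 2 + e ^ 4) - α +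
        α ^ 2 * (1 - e ^ 2 - e ^ 4)) / (1 + e ^ 2) := by
    have h3 : 1 + e ^ 2 ≠ 0 := by positivity
    have h4 : a + e ^ 2 * a = a * (1 + e ^ 2) := by ring
    rw [h4, ha']
    field_simp
    ring
  have hpos : 0 < 2 + 3 * e ^ 2 - 2 * e - e ^ 3 + α * (4 * e + 2 * e ^ 3 + e ^ 2 + e ^ 4) - α +
      α ^ 2 * (1 - e ^ 2 - e ^ 4) := by
    have k1 : e ^ 3 ≤ e ^ 2 := pow_le_pow_of_le_one he.le he1 (by norm_num)
    have k2 : 0 ≤ α * (1 - α) * (e ^ 2 + e ^ 4) :=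
      mul_nonneg (mul_nonneg hα (by linarith)) (by positivity)
    have k3 : 0 ≤ α * (4 * e + 2 * e ^ 3) := by positivity
    nlinarith [sq_nonneg (α - 1 / 2), sq_nonneg (e - 1 / 2)]
  have : 0 < e * (2 + 3 * e ^ 2 - 2 * e - e ^ 3 + α * (4 * e + 2 * e ^ 3 + e ^ 2 + e ^ 4) - α +
        α ^ 2 * (1 - e ^ 2 - e ^ 4)) / (1 + e ^ 2) := by positivity
  linarith

end Measure

/-! ### Assembly -/

theorem mainTheorem3 (n : ℕ) (μ : PMF (Finset (Fin n))) (A : Matrix (Fin n) (Fin n) ℂ)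
    (ε α : ℝ)
    (hhom : IsHomogeneousMeasure μ) (hSR : IsStronglyRayleigh μ)
    (hmarg : ∀ i, marginal μ i ≤ ε)
    (hpsd : A.PosSemidef) (hcontr : IsMatrixContraction A)
    (hdiag : ∀ i, (A i i).re ≤ α)
    (hαε : Real.sqrt α + Real.sqrt ε ≤ 1) :
    0 < prob μ {S | lambdaMax (principalSubmatrix A S)
      < ((4 * ε ^ (1 / 4 : ℝ) + α : ℝ) : EReal)} := by
  obtain ⟨d, hd⟩ := hhom
  have hm := stableWeight_pmfWeight hd hSR
  have hH := hpsd.isHermitian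
  suffices H : ∃ S, 0 < pmfWeight μ S ∧ lambdaMax (principalSubmatrix A S) <
      ((4 * ε ^ (1 / 4 : ℝ) + α : ℝ) : EReal) by
    obtain ⟨S, hS, hlt⟩ := H
    classical
    rw [prob_eq_sum]
    refine Finset.sum_pos' (fun T _ => ?_) ⟨S, Finset.mem_univ S, ?_⟩
    · split_ifs
      · exact hm.nonneg T
      · exact le_rfl
    · rwa [if_pos (show S ∈ {S | lambdaMax (principalSubmatrix A S) < _} from hlt)]
  obtain ⟨S₀, -, hS₀⟩ := Finset.exists_ne_zero_of_sum_ne_zero hm.sum_pos.ne'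
  have hS₀pos := (hm.nonneg S₀).lt_of_ne' hS₀
  -- If the empty set has positive mass it already works, its `lambdaMax` being `-∞`. Otherwise some
  -- marginal is positive, and hence so is `ε`, as division by `e` requires.
  rcases S₀.eq_empty_or_nonempty with rfl | ⟨i, hi⟩
  · exact ⟨∅, hS₀pos, lambdaMax_lt (hH.submatrix Subtype.val)
      (b := 4 * ε ^ (1 / 4 : ℝ) + α - 1) (fun i => absurd i.2 (Finset.notMem_empty _))
      (by linarith)⟩
  have hε : 0 < ε := by
    refine lt_of_lt_of_le ?_ (hmarg i)
    rw [marginal_eq_sum]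
    refine Finset.sum_pos' (fun S _ => ?_) ⟨S₀, Finset.mem_univ _, ?_⟩
    · have := hm.nonneg S
      unfold weightIn
      split_ifs <;> simp [this]
    · rwa [weightIn, if_pos hi]
  have hα : 0 ≤ α := (Complex.nonneg_iff.1 (hpsd.diag_nonneg (i := i))).1.trans (hdiag i)
  set e := ε ^ (1 / 4 : ℝ) with he
  have he0 : 0 < e := Real.rpow_pos_of_pos hε _
  have he4 : e ^ 4 = ε := by
    rw [he, ← Real.rpow_natCast, ← Real.rpow_mul hε.le]
    norm_num
  have hsqrt : Real.sqrt ε = e ^ 2 := by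
    rw [← he4, show e ^ 4 = (e ^ 2) ^ 2 by ring, Real.sqrt_sq (by positivity)]
  have hα1 : α < 1 := by
    have h1 : Real.sqrt α < 1 := by
      rw [hsqrt] at hαε
      have : 0 < e ^ 2 := by positivity
      linarith
    have := (Real.sqrt_lt' one_pos).1 h1
    linarith
  have he1 : e ≤ 1 := by
    rw [hsqrt] at hαε
    have := Real.sqrt_nonneg α
    nlinarith
  have h1A := posSemidef_one_sub_of_contraction hH hcontr
  obtain ⟨a, ha⟩ : ∃ a, a = (e⁻¹ + 1 - α)⁻¹ + ((e⁻¹ + 1 - α) * (e⁻¹ + 1 - α - 1))⁻¹ * α :=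
    ⟨_, rfl⟩
  obtain ⟨ha0, hlt⟩ := barrier_value_lt he0 he1 hα hα1 ha
  have hx : 1 < e⁻¹ + 1 - α := by
    have := one_le_inv₀ he0 |>.2 he1
    linarith
  have hb : 0 < e ^ 2 * a := by positivity
  have hy : 0 < e ^ 4 / (e ^ 2 * a) := by positivity
  obtain ⟨S, hS, hSpos⟩ := hm.exists_realCharpoly_pos hH (fun x hx' =>
    mixedCharpoly_pos hH hm.stable ha0 hb
      (fun z hz => realValue_borderedDet_pos h1A fun i => hx.trans_le (hz i))
      (fun i => by
        rw [ha]
        exact realValue_borderedDet_singleton_le hpsd h1A hx (hdiag i))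
      (fun w hw => realValue_weightPoly_pos hm fun i => hy.trans_le (hw i))
      (fun i => by
        have h := realValue_slopeIn_weightPoly_le hm hy (i := i) (ε := ε) (by
          rw [sum_pmfWeight, mul_one, ← marginal_eq_sum]
          exact hmarg i)
        rwa [← he4, div_div_cancel₀ (by positivity)] at h)
      hx')
  exact ⟨S, hS, lambdaMax_lt (hH.submatrix Subtype.val)
    (fun i => (eigenvalues_lt_of_realCharpoly_pos hH hSpos i).le) hlt⟩
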